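/- Let $\mathbb{D}$ be the unit disc and $dA=\frac{dx\,dy}{\pi}$. Let $\omega\in L^1([0,1))$ be nonnegative with $\widehat{\omega}(r)=\int_r^1\omega(s)\,ds>0$ for all $0\le r<1$, and extend $\omega$ to a radial weight on $\mathbb{D}$ by $\omega(z)=\omega(|z|)$. For $1<p<\infty$ let $L^p_\omega$ be the Lebesgue space of measurable functions on $\mathbb{D}$ with $\|f\|_{L^p_\omega}^p=\int_{\mathbb{D}}|f|^p\,\omega\,dA<\infty$. Let $A^2_\omega$ be the space of analytic functions in $L^2_\omega$, let $B^\omega_z$ be its reproducing kernel at $z\in\mathbb{D}$ (so $B^\omega_z\in A^2_\omega$ and $f(z)=\int_{\mathbb{D}}f\,\overline{B^\omega_z}\,\omega\,dA$ for all $f\in A^2_\omega$), and let $$P^+_\omega(f)(z)=\int_{\mathbb{D}}f(\zeta)\,|B^\omega_z(\zeta)|\,\omega(\zeta)\,dA(\zeta)$$ be the maximal Bergman projection. Write $\omega\in\widehat{\mathcal{D}}$ if there exists $C\ge1$ such that $\widehat{\omega}(r)\le C\,\widehat{\omega}\left(\frac{1+r}{2}\right)$ for all $0\le r<1$; write $\omega\in\check{\mathcal{D}}$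 if there exist $K>1$ and $C>1$ such that $\widehat{\omega}(r)\ge C\,\widehat{\omega}\left(1-\frac{1-r}{K}\right)$ for all $0\le r<1$; and let $\mathcal{D}=\widehat{\mathcal{D}}\cap\check{\mathcal{D}}$. **Theorem.** Let $\omega\in\widehat{\mathcal{D}}$ and $1<p<\infty$. Then $P^+_\omega:L^p_\omega\to L^p_\omega$ is bounded if and only if $\omega\in\mathcal{D}$. -/

import Mathlib

open MeasureTheory Set Filter Topology
open scoped ComplexConjugate ENNReal NNReal

noncomputable section

namespace RadialBergman

/-- `ω` is the radial profile of a radial weight on the unit disc: a nonnegative integrable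
function on `[0, 1)`. The weight itself is `z ↦ ω ‖z‖`; values of `ω` outside `[0, 1)` play
no role. -/
structure IsRadialWeight (ω : ℝ → ℝ) : Prop where
  nonneg : ∀ r ∈ Ico (0 : ℝ) 1, 0 ≤ ω r
  integrable : IntegrableOn ω (Ico (0 : ℝ) 1)

/-- The tail integral `ω̂(r) = ∫_r^1 ω(s) ds`. -/
def tail (ω : ℝ → ℝ) (r : ℝ) : ℝ := ∫ s in r..1, ω s

/-- Upper doubling of the tail integral (the class `D̂`). -/
def UpperDoubling (ω : ℝ → ℝ) : Prop :=
  ∃ C : ℝ, 1 ≤ C ∧ ∀ r ∈ Ico (0 : ℝ) 1, tail ω r ≤ C * tail ω ((1 + r) / 2)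

/-- Lower (reverse) doubling of the tail integral (the class `Ď`). -/
def LowerDoubling (ω : ℝ → ℝ) : Prop :=
  ∃ K C : ℝ, 1 < K ∧ 1 < C ∧ ∀ r ∈ Ico (0 : ℝ) 1, C * tail ω (1 - (1 - r) / K) ≤ tail ω r

/-- Two-sided doubling: the class `D = D̂ ∩ Ď`. -/
def TwoSidedDoubling (ω : ℝ → ℝ) : Prop := UpperDoubling ω ∧ LowerDoubling ω

/-- The normalized area measure `dA = dx dy / π` on the open unit disc, as a measure on `ℂ`. -/
def normalizedArea : Measure ℂ :=
  ENNReal.ofReal Real.pi⁻¹ • volume.restrict (Metric.ball (0 : ℂ) 1)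

/-- The measure `ω dA` on the open unit disc. -/
def weightedArea (ω : ℝ → ℝ) : Measure ℂ :=
  normalizedArea.withDensity fun z => ENNReal.ofReal (ω ‖z‖)

/-- Membership in the weighted Bergman space `A^p_ω`: analytic in the unit disc and in `L^p_ω`. -/
def MemBergman (ω : ℝ → ℝ) (p : ℝ≥0∞) (f : ℂ → ℂ) : Prop :=
  DifferentiableOn ℂ f (Metric.ball 0 1) ∧ MemLp f p (weightedArea ω)

/-- `K` is the reproducing kernel function of `A²_ω` at the point `z`:
`K ∈ A²_ω` and `f(z) = ∫ f \overline{K} ω dA` for all `f ∈ A²_ω`. -/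
def IsReproducingKernelAt (ω : ℝ → ℝ) (z : ℂ) (K : ℂ → ℂ) : Prop :=
  MemBergman ω 2 K ∧
    ∀ f : ℂ → ℂ, MemBergman ω 2 f → f z = ∫ ζ, f ζ * conj (K ζ) ∂(weightedArea ω)

/-- The reproducing kernel `B^ω_z` of `A²_ω`, as a function of `ζ`. For a radial weight with
positive tail integral and `z` in the disc it exists (`isReproducingKernelAt_bergmanKernel`) and
is unique on the disc (`IsReproducingKernelAt.eqOn`). -/
def bergmanKernel (ω : ℝ → ℝ) (z : ℂ) : ℂ → ℂ :=
  Classical.epsilon (IsReproducingKernelAt ω z)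

section Existence

variable {ω : ℝ → ℝ}

lemma integrable_weight (hω : IsRadialWeight ω) :
    IntegrableOn (fun z : ℂ => ω ‖z‖) (Metric.ball 0 1) := by
  have h := (integrable_fun_norm_addHaar (μ := (volume : Measure ℂ))
    (f := (Ico (0 : ℝ) 1).indicator ω)).2 ?_
  · rw [← integrable_indicator_iff Metric.isOpen_ball.measurableSet]
    refine h.congr (Eventually.of_forall fun z => ?_)
    by_cases hz : ‖z‖ < 1 <;> simp [indicator, hz]
  · have h1 : IntegrableOn ((Ico (0 : ℝ) 1).indicator ω) (Ioi 0) :=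
      (hω.integrable.integrable_indicator measurableSet_Ico).integrableOn
    have h2 : IntegrableOn (fun y => y * ω y) (Ico (0 : ℝ) 1) := by
      refine Integrable.mono hω.integrable (measurable_id.aestronglyMeasurable.mul
        hω.integrable.aestronglyMeasurable) ?_
      filter_upwards [ae_restrict_mem measurableSet_Ico] with y hy
      have := abs_of_nonneg hy.1
      simp only [norm_mul, Real.norm_eq_abs, this]
      exact mul_le_of_le_one_left (abs_nonneg _) hy.2.le
    have h3 : IntegrableOn ((Ico (0 : ℝ) 1).indicator (fun y => y * ω y)) (Ioi 0) :=
      (h2.integrable_indicator measurableSet_Ico).integrableOn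
    refine h3.congr (Eventually.of_forall fun y => ?_)
    by_cases hy : y ∈ Ico (0 : ℝ) 1 <;> simp [indicator, Complex.finrank_real_complex, hy]

lemma aemeasurable_weight (hω : IsRadialWeight ω) :
    AEMeasurable (fun z : ℂ => ENNReal.ofReal (ω ‖z‖)) normalizedArea := by
  have := (integrable_weight hω).aestronglyMeasurable.aemeasurable.ennreal_ofReal
  exact this.smul_measure _

lemma weightedArea_restrict_ball :
    (weightedArea ω).restrict (Metric.ball 0 1) = weightedArea ω := by
  rw [weightedArea, restrict_withDensity Metric.isOpen_ball.measurableSet, normalizedArea,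
    Measure.restrict_smul, Measure.restrict_restrict Metric.isOpen_ball.measurableSet, inter_self]

lemma ae_mem_ball : ∀ᵐ z ∂(weightedArea ω), z ∈ Metric.ball (0 : ℂ) 1 := by
  rw [← weightedArea_restrict_ball]
  exact ae_restrict_mem Metric.isOpen_ball.measurableSet

lemma isFiniteMeasure_weightedArea (hω : IsRadialWeight ω) :
    IsFiniteMeasure (weightedArea ω) := by
  refine isFiniteMeasure_withDensity ?_
  rw [normalizedArea, lintegral_smul_measure]
  refine ENNReal.mul_ne_top ENNReal.ofReal_ne_top ?_
  exact (integrable_weight hω).lintegral_lt_top.ne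

/-- Integrals against `ω dA` over a centred disc as plain area integrals. -/
lemma setIntegral_weightedArea (hω : IsRadialWeight ω) {ρ : ℝ} (hρ : ρ ≤ 1) (g : ℂ → ℂ) :
    ∫ z in Metric.ball 0 ρ, g z ∂(weightedArea ω) =
      Real.pi⁻¹ • ∫ z, (Metric.ball (0 : ℂ) ρ).indicator (fun z => (ω ‖z‖ : ℂ) * g z) z := by
  rw [weightedArea, setIntegral_withDensity_eq_setIntegral_toReal_smul₀
      ((aemeasurable_weight hω).restrict)
      (Eventually.of_forall fun _ => ENNReal.ofReal_lt_top) _ Metric.isOpen_ball.measurableSet,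
    normalizedArea, Measure.restrict_smul, integral_smul_measure,
    ENNReal.toReal_ofReal (by positivity),
    Measure.restrict_restrict Metric.isOpen_ball.measurableSet,
    inter_eq_left.2 (Metric.ball_subset_ball hρ),
    integral_indicator Metric.isOpen_ball.measurableSet]
  congr 1
  refine setIntegral_congr_fun Metric.isOpen_ball.measurableSet fun z hz => ?_
  have hz1 : ‖z‖ < 1 := (by simpa using hz : ‖z‖ < ρ).trans_le hρ
  simp [ENNReal.toReal_ofReal (hω.nonneg ‖z‖ ⟨norm_nonneg _, hz1⟩)]

/-- Distinct monomials are orthogonal on centred discs. -/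
lemma setIntegral_monomial_eq_zero (hω : IsRadialWeight ω) {ρ : ℝ} (hρ : ρ ≤ 1) {k n : ℕ}
    (hkn : k ≠ n) :
    ∫ z in Metric.ball 0 ρ, z ^ k * conj z ^ n ∂(weightedArea ω) = 0 := by
  rw [setIntegral_weightedArea hω hρ]
  set G : ℂ → ℂ :=
    (Metric.ball (0 : ℂ) ρ).indicator (fun z => (ω ‖z‖ : ℂ) * (z ^ k * conj z ^ n)) with hG
  set α : ℝ := Real.pi / ((k : ℝ) - n) with hα
  have hkn' : (k : ℝ) - n ≠ 0 := sub_ne_zero.2 (by exact_mod_cast hkn)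
  set u : Circle := Circle.exp α with hu
  have hmp := (rotation u).measurePreserving
  have hcomp : ∫ z, G (rotation u z) = ∫ z, G z :=
    hmp.integral_comp (rotation u).toHomeomorph.measurableEmbedding G
  have hrot : ∀ z, G (rotation u z) = -G z := by
    intro z
    have hun : (u : ℂ) ^ k * conj (u : ℂ) ^ n = -1 := by
      have h1 : conj (u : ℂ) = Complex.exp (-(α * Complex.I)) := by
        rw [hu, Circle.coe_exp, ← Complex.exp_conj]; simp
      rw [h1, hu, Circle.coe_exp, ← Complex.exp_nat_mul, ← Complex.exp_nat_mul,
        ← Complex.exp_add, ← Complex.exp_pi_mul_I]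
      congr 1
      have : (α : ℂ) * ((k : ℂ) - n) = Real.pi := by
        rw [hα]
        have h2 : ((k : ℂ) - n) ≠ 0 := by exact_mod_cast hkn'
        push_cast
        field_simp
      linear_combination Complex.I * this
    have hn : ‖(u : ℂ) * z‖ = ‖z‖ := by rw [norm_mul, Circle.norm_coe, one_mul]
    simp only [hG, rotation_apply, indicator, Metric.mem_ball, dist_zero_right, hn]
    split_ifs
    · rw [map_mul, mul_pow, mul_pow]
      linear_combination (ω ‖z‖ : ℂ) * z ^ k * conj z ^ n * hun
    · simp
  have h0 : ∫ z, G z = 0 := by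
    simp only [hrot, integral_neg] at hcomp
    have : (2 : ℂ) * ∫ z, G z = 0 := by linear_combination -hcomp
    simpa using this
  rw [h0, smul_zero]

/-- Squared norm of a monomial. -/
def monomialNormSq (ω : ℝ → ℝ) (n : ℕ) : ℝ := ∫ z, ‖z‖ ^ (2 * n) ∂(weightedArea ω)

lemma integrable_of_bounded (hω : IsRadialWeight ω) {E : Type*} [NormedAddCommGroup E]
    {g : ℂ → E} (hg : AEStronglyMeasurable g (weightedArea ω)) (C : ℝ)
    (hC : ∀ z ∈ Metric.ball (0 : ℂ) 1, ‖g z‖ ≤ C) : Integrable g (weightedArea ω) := by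
  have := isFiniteMeasure_weightedArea hω
  refine Integrable.of_bound hg C ?_
  filter_upwards [ae_mem_ball] with z hz using hC z hz

lemma aestronglyMeasurable_of_differentiableOn {f : ℂ → ℂ}
    (hf : DifferentiableOn ℂ f (Metric.ball 0 1)) :
    AEStronglyMeasurable f (weightedArea ω) := by
  rw [← weightedArea_restrict_ball]
  exact hf.continuousOn.aestronglyMeasurable Metric.isOpen_ball.measurableSet

lemma weightedArea_annulus_pos (hω : IsRadialWeight ω)
    (hpos : ∀ r ∈ Ico (0 : ℝ) 1, 0 < tail ω r) {r : ℝ} (hr : r ∈ Ico (0 : ℝ) 1) :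
    0 < (weightedArea ω).real {z | r < ‖z‖ ∧ ‖z‖ < 1} := by
  have := isFiniteMeasure_weightedArea hω
  rw [measureReal_def, ENNReal.toReal_pos_iff]
  refine ⟨pos_iff_ne_zero.2 fun h0 => ?_, measure_lt_top _ _⟩
  have hms : MeasurableSet {z : ℂ | r < ‖z‖ ∧ ‖z‖ < 1} :=
    (measurableSet_lt measurable_const measurable_norm).inter
      (measurableSet_lt measurable_norm measurable_const)
  have hsub : {z : ℂ | r < ‖z‖ ∧ ‖z‖ < 1} ⊆ Metric.ball 0 1 := fun z hz => by simpa using hz.2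
  rw [weightedArea, withDensity_apply _ hms, normalizedArea, Measure.restrict_smul,
    lintegral_smul_measure, Measure.restrict_restrict hms, inter_eq_left.2 hsub, smul_eq_mul,
    mul_eq_zero, or_iff_right (by simp [Real.pi_pos]),
    ← ofReal_integral_eq_lintegral_ofReal ((integrable_weight hω).mono_set hsub) ?_,
    ENNReal.ofReal_eq_zero, ← integral_indicator hms] at h0
  swap
  · filter_upwards [ae_restrict_mem hms] with z hz using hω.nonneg _ ⟨norm_nonneg _, hz.2⟩
  have h1 : (fun z : ℂ => {z : ℂ | r < ‖z‖ ∧ ‖z‖ < 1}.indicator (fun z => ω ‖z‖) z) =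
      fun z => (Ioo r 1).indicator ω ‖z‖ := by
    ext z; simp [indicator]
  rw [h1, integral_fun_norm_addHaar] at h0
  have hball : 0 < (volume : Measure ℂ).real (Metric.ball 0 1) :=
    ENNReal.toReal_pos (Metric.measure_ball_pos _ _ one_pos).ne' measure_ball_lt_top.ne
  simp only [Complex.finrank_real_complex, nsmul_eq_mul, smul_eq_mul] at h0
  have h2 : ∫ y in Ioi (0 : ℝ), y ^ (2 - 1) * (Ioo r 1).indicator ω y = ∫ y in Ioo r 1, y * ω y := by
    have : ∀ y, y ^ (2 - 1) * (Ioo r 1).indicator ω y = (Ioo r 1).indicator (fun y => y * ω y) y := by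
      intro y; by_cases hy : y ∈ Ioo r 1 <;> simp [indicator, hy]
    simp only [this]
    rw [setIntegral_indicator measurableSet_Ioo, inter_eq_right.2]
    exact fun y hy => hr.1.trans_lt hy.1
  rw [h2] at h0
  have hint : IntegrableOn ω (Ioo r 1) :=
    hω.integrable.mono_set fun y hy => ⟨hr.1.trans hy.1.le, hy.2⟩
  have hint' : IntegrableOn (fun y => y * ω y) (Ioo r 1) := by
    refine Integrable.mono hint (measurable_id.aestronglyMeasurable.mul hint.aestronglyMeasurable) ?_
    filter_upwards [ae_restrict_mem measurableSet_Ioo] with y hy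
    have := abs_of_nonneg (hr.1.trans hy.1.le)
    simp only [norm_mul, Real.norm_eq_abs, this]
    exact mul_le_of_le_one_left (abs_nonneg _) hy.2.le
  have hnn : 0 ≤ᵐ[volume.restrict (Ioo r 1)] fun y => y * ω y := by
    filter_upwards [ae_restrict_mem measurableSet_Ioo] with y hy
    exact mul_nonneg (hr.1.trans hy.1.le) (hω.nonneg y ⟨hr.1.trans hy.1.le, hy.2⟩)
  have h3 : ∫ y in Ioo r 1, y * ω y = 0 := by
    refine le_antisymm ?_ (integral_nonneg_of_ae hnn)
    by_contra! hlt
    have := mul_pos (mul_pos (by norm_num : (0 : ℝ) < (2 : ℕ)) hball) hlt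
    simp only [mul_assoc] at this h0
    linarith
  rw [integral_eq_zero_iff_of_nonneg_ae hnn hint'] at h3
  have h4 : ω =ᵐ[volume.restrict (Ioo r 1)] 0 := by
    filter_upwards [h3, ae_restrict_mem measurableSet_Ioo] with y hy hy'
    simpa [(hr.1.trans_lt hy'.1).ne'] using hy
  have h5 := hpos r hr
  rw [tail, intervalIntegral.integral_of_le hr.2.le, ← restrict_Ioo_eq_restrict_Ioc,
    integral_congr_ae h4] at h5
  simp at h5

lemma le_monomialNormSq (hω : IsRadialWeight ω) {r : ℝ} (hr : r ∈ Ico (0 : ℝ) 1) (n : ℕ) :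
    r ^ (2 * n) * (weightedArea ω).real {z | r < ‖z‖ ∧ ‖z‖ < 1} ≤ monomialNormSq ω n := by
  have := isFiniteMeasure_weightedArea hω
  have hms : MeasurableSet {z : ℂ | r < ‖z‖ ∧ ‖z‖ < 1} :=
    (measurableSet_lt measurable_const measurable_norm).inter
      (measurableSet_lt measurable_norm measurable_const)
  have hint : Integrable (fun z : ℂ => ‖z‖ ^ (2 * n)) (weightedArea ω) := by
    refine integrable_of_bounded hω (by fun_prop) 1 fun z hz => ?_
    simpa using pow_le_one₀ (norm_nonneg _) (by simpa using hz : ‖z‖ < 1).le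
  calc _ = ∫ _ in {z : ℂ | r < ‖z‖ ∧ ‖z‖ < 1}, r ^ (2 * n) ∂(weightedArea ω) := by
        simp [mul_comm]
    _ ≤ ∫ z in {z : ℂ | r < ‖z‖ ∧ ‖z‖ < 1}, ‖z‖ ^ (2 * n) ∂(weightedArea ω) := by
        refine setIntegral_mono_on (integrable_const _).integrableOn hint.integrableOn hms ?_
        exact fun z hz => pow_le_pow_left₀ hr.1 hz.1.le _
    _ ≤ _ := setIntegral_le_integral hint (Eventually.of_forall fun z => by positivity)

lemma monomialNormSq_pos (hω : IsRadialWeight ω)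
    (hpos : ∀ r ∈ Ico (0 : ℝ) 1, 0 < tail ω r) (n : ℕ) : 0 < monomialNormSq ω n :=
  (mul_pos (by positivity) (weightedArea_annulus_pos hω hpos
    (r := 1 / 2) (by norm_num))).trans_le (le_monomialNormSq hω (by norm_num) n)

lemma summable_kernel (hω : IsRadialWeight ω)
    (hpos : ∀ r ∈ Ico (0 : ℝ) 1, 0 < tail ω r) {z : ℂ} (hz : z ∈ Metric.ball (0 : ℂ) 1) :
    Summable fun n : ℕ => ‖z‖ ^ n / monomialNormSq ω n := by
  have hz1 : ‖z‖ < 1 := by simpa using hz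
  obtain ⟨s, hs, hs1⟩ := exists_between hz1
  have hs0 : 0 < s := (norm_nonneg z).trans_lt hs
  set r := Real.sqrt s with hr
  have hr2 : r ^ 2 = s := Real.sq_sqrt hs0.le
  have hr1 : r ∈ Ico (0 : ℝ) 1 := ⟨Real.sqrt_nonneg _, by
    rw [hr]; simpa using Real.sqrt_lt_sqrt hs0.le hs1⟩
  set c := (weightedArea ω).real {z | r < ‖z‖ ∧ ‖z‖ < 1} with hc
  have hc0 : 0 < c := weightedArea_annulus_pos hω hpos hr1
  refine Summable.of_nonneg_of_le
    (fun n => div_nonneg (by positivity) (monomialNormSq_pos hω hpos n).le) (fun n => ?_)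
    ((summable_geometric_of_lt_one (by positivity : 0 ≤ ‖z‖ / s)
      ((div_lt_one hs0).2 hs)).mul_right c⁻¹)
  have h := le_monomialNormSq hω hr1 n
  rw [pow_mul, hr2, ← hc] at h
  calc _ ≤ ‖z‖ ^ n / (s ^ n * c) := by gcongr
    _ = _ := by rw [div_pow]; field_simp

/-- Each Maclaurin coefficient is obtained by pairing with a monomial. -/
lemma integral_mul_conj_pow (hω : IsRadialWeight ω) {f : ℂ → ℂ} (hf : MemBergman ω 2 f)
    {a : ℕ → ℂ} (ha : ∀ z ∈ Metric.ball (0 : ℂ) 1, HasSum (fun k => a k * z ^ k) (f z)) (n : ℕ) :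
    ∫ z, f z * conj z ^ n ∂(weightedArea ω) = a n * monomialNormSq ω n := by
  have := isFiniteMeasure_weightedArea hω
  have hfint : Integrable f (weightedArea ω) := hf.2.integrable (by norm_num)
  have hint : Integrable (fun z => f z * conj z ^ n) (weightedArea ω) := by
    refine hfint.mul_bdd (c := 1) (by fun_prop) ?_
    filter_upwards [ae_mem_ball] with z hz
    simpa using pow_le_one₀ (norm_nonneg _) (by simpa using hz : ‖z‖ < 1).le
  have hint2 : Integrable (fun z : ℂ => z ^ n * conj z ^ n) (weightedArea ω) := by
    refine integrable_of_bounded hω (by fun_prop) 1 fun z hz => ?_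
    have h1 := pow_le_one₀ (n := n) (norm_nonneg _) (by simpa using hz : ‖z‖ < 1).le
    simpa using mul_le_one₀ h1 (by positivity) h1
  have hball : ∀ m : ℕ, ∫ z in Metric.ball 0 (1 - 1 / ((m : ℝ) + 1)),
      f z * conj z ^ n ∂(weightedArea ω) =
      a n * ∫ z in Metric.ball 0 (1 - 1 / ((m : ℝ) + 1)), z ^ n * conj z ^ n ∂(weightedArea ω) := by
    intro m
    set ρ : ℝ := 1 - 1 / ((m : ℝ) + 1) with hρ
    have hρ1 : ρ < 1 := by rw [hρ]; linarith [Nat.one_div_pos_of_nat (α := ℝ) (n := m)]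
    have hρ0 : 0 ≤ ρ := by
      rw [hρ, sub_nonneg, div_le_one (by positivity)]; linarith [(Nat.cast_nonneg m : (0 : ℝ) ≤ m)]
    have hsum : Summable fun k => ‖a k‖ * ρ ^ k := by
      have := (ha (ρ : ℂ) (by simpa [abs_of_nonneg hρ0] using hρ1)).summable.norm
      simpa [abs_of_nonneg hρ0] using this
    have hb : ∀ k : ℕ, ∀ z ∈ Metric.ball (0 : ℂ) ρ, ‖a k * z ^ k * conj z ^ n‖ ≤ ‖a k‖ * ρ ^ k := by
      intro k z hz
      have hz' : ‖z‖ < ρ := by simpa using hz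
      simp only [norm_mul, norm_pow, RCLike.norm_conj]
      calc _ ≤ ‖a k‖ * ρ ^ k * 1 := by
            gcongr
            exact pow_le_one₀ (norm_nonneg _) (hz'.le.trans hρ1.le)
        _ = _ := mul_one _
    have hterm : ∀ k, ∫ z in Metric.ball 0 ρ, a k * z ^ k * conj z ^ n ∂(weightedArea ω) =
        if k = n then a n * ∫ z in Metric.ball 0 ρ, z ^ n * conj z ^ n ∂(weightedArea ω) else 0 := by
      intro k
      simp only [mul_assoc]
      rw [integral_const_mul]
      split_ifs with hk
      · rw [hk]
      · rw [setIntegral_monomial_eq_zero hω hρ1.le hk, mul_zero]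
    have hkint : ∀ k, Integrable (fun z => a k * z ^ k * conj z ^ n)
        ((weightedArea ω).restrict (Metric.ball 0 ρ)) := by
      intro k
      refine Integrable.of_bound (by fun_prop) (‖a k‖ * ρ ^ k) ?_
      filter_upwards [ae_restrict_mem Metric.isOpen_ball.measurableSet] with z hz using hb k z hz
    have hS := hasSum_integral_of_summable_integral_norm hkint ?_
    · simp only [hterm] at hS
      have h1 := hS.unique (hasSum_ite_eq n _)
      rw [← h1]
      refine setIntegral_congr_fun Metric.isOpen_ball.measurableSet fun z hz => ?_
      exact (((ha z (Metric.ball_subset_ball hρ1.le hz)).mul_right (conj z ^ n)).tsum_eq).symm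
    · refine Summable.of_nonneg_of_le (fun k => integral_nonneg fun z => norm_nonneg _) (fun k => ?_)
        (hsum.mul_right ((weightedArea ω).real (Metric.ball 0 ρ)))
      calc _ ≤ ∫ _ in Metric.ball (0 : ℂ) ρ, ‖a k‖ * ρ ^ k ∂(weightedArea ω) := by
            refine setIntegral_mono_on (hkint k).norm (integrable_const _).integrableOn
              Metric.isOpen_ball.measurableSet (hb k)
        _ = _ := by simp [mul_comm]
  have hmono : Monotone fun m : ℕ => Metric.ball (0 : ℂ) (1 - 1 / ((m : ℝ) + 1)) := by
    intro m m' h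
    refine Metric.ball_subset_ball ?_
    have : (m : ℝ) ≤ m' := by exact_mod_cast h
    gcongr
  have hunion : (⋃ m : ℕ, Metric.ball (0 : ℂ) (1 - 1 / ((m : ℝ) + 1))) = Metric.ball 0 1 := by
    ext z
    simp only [mem_iUnion, Metric.mem_ball, dist_zero_right]
    constructor
    · rintro ⟨m, hm⟩
      linarith [Nat.one_div_pos_of_nat (α := ℝ) (n := m)]
    · intro hz
      obtain ⟨m, hm⟩ := exists_nat_one_div_lt (sub_pos.2 hz)
      exact ⟨m, by linarith⟩
  have hlim : ∀ g : ℂ → ℂ, Integrable g (weightedArea ω) →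
      Tendsto (fun m : ℕ => ∫ z in Metric.ball 0 (1 - 1 / ((m : ℝ) + 1)), g z ∂(weightedArea ω))
        atTop (𝓝 (∫ z, g z ∂(weightedArea ω))) := by
    intro g hg
    have := tendsto_setIntegral_of_monotone (μ := weightedArea ω) (f := g)
      (fun m : ℕ => (Metric.isOpen_ball (x := (0 : ℂ))
        (ε := 1 - 1 / ((m : ℝ) + 1))).measurableSet) hmono hg.integrableOn
    rwa [hunion, weightedArea_restrict_ball] at this
  have h1 := hlim _ hint
  simp only [hball] at h1
  rw [tendsto_nhds_unique h1 ((hlim _ hint2).const_mul (a n))]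
  congr 1
  rw [monomialNormSq, ← integral_complex_ofReal]
  congr 1 with z
  rw [← mul_pow, Complex.mul_conj, pow_mul, Complex.normSq_eq_norm_sq]
  push_cast
  rfl

/-- The orthonormal expansion of the kernel in normalized monomials. -/
def kernelSeries (ω : ℝ → ℝ) (z ζ : ℂ) : ℂ := ∑' n : ℕ, (conj z * ζ) ^ n / monomialNormSq ω n

lemma norm_kernel_term_le (hω : IsRadialWeight ω)
    (hpos : ∀ r ∈ Ico (0 : ℝ) 1, 0 < tail ω r) (z : ℂ) (n : ℕ) {ζ : ℂ}
    (hζ : ζ ∈ Metric.ball (0 : ℂ) 1) :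
    ‖(conj z * ζ) ^ n / (monomialNormSq ω n : ℂ)‖ ≤ ‖z‖ ^ n / monomialNormSq ω n := by
  have hm := monomialNormSq_pos hω hpos n
  have hζ' : ‖ζ‖ < 1 := by simpa using hζ
  simp only [norm_div, norm_pow, norm_mul, RCLike.norm_conj, Complex.norm_real, Real.norm_eq_abs,
    abs_of_pos hm]
  gcongr
  exact mul_le_of_le_one_right (norm_nonneg _) hζ'.le

lemma memBergman_kernelSeries (hω : IsRadialWeight ω)
    (hpos : ∀ r ∈ Ico (0 : ℝ) 1, 0 < tail ω r) {z : ℂ} (hz : z ∈ Metric.ball (0 : ℂ) 1) :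
    MemBergman ω 2 (kernelSeries ω z) := by
  have := isFiniteMeasure_weightedArea hω
  have hd : DifferentiableOn ℂ (kernelSeries ω z) (Metric.ball 0 1) :=
    Complex.differentiableOn_tsum_of_summable_norm (summable_kernel hω hpos hz)
      (fun n => by fun_prop) Metric.isOpen_ball fun n ζ hζ => norm_kernel_term_le hω hpos z n hζ
  refine ⟨hd, MemLp.of_bound (aestronglyMeasurable_of_differentiableOn hd)
    (∑' n : ℕ, ‖z‖ ^ n / monomialNormSq ω n) ?_⟩
  filter_upwards [ae_mem_ball] with ζ hζ
  exact tsum_of_norm_bounded (summable_kernel hω hpos hz).hasSum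
    fun n => norm_kernel_term_le hω hpos z n hζ

theorem isReproducingKernelAt_kernelSeries (hω : IsRadialWeight ω)
    (hpos : ∀ r ∈ Ico (0 : ℝ) 1, 0 < tail ω r) {z : ℂ} (hz : z ∈ Metric.ball (0 : ℂ) 1) :
    IsReproducingKernelAt ω z (kernelSeries ω z) := by
  have := isFiniteMeasure_weightedArea hω
  refine ⟨memBergman_kernelSeries hω hpos hz, fun f hf => ?_⟩
  have ha : ∀ w ∈ Metric.ball (0 : ℂ) 1,
      HasSum (fun k : ℕ => ((k.factorial : ℂ)⁻¹ * iteratedDeriv k f 0) * w ^ k) (f w) := by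
    intro w hw
    refine (Complex.hasSum_taylorSeries_on_ball hf.1 hw).congr_fun fun k => ?_
    simp only [sub_zero, smul_eq_mul]; ring
  set a : ℕ → ℂ := fun k => (k.factorial : ℂ)⁻¹ * iteratedDeriv k f 0 with ha'
  have hfint : Integrable f (weightedArea ω) := hf.2.integrable (by norm_num)
  set c : ℕ → ℂ := fun n => z ^ n / (monomialNormSq ω n : ℂ) with hc
  have hcn : ∀ n, ‖c n‖ = ‖z‖ ^ n / monomialNormSq ω n := fun n => by
    simp [hc, abs_of_pos (monomialNormSq_pos hω hpos n)]
  have hconj : ∀ ζ n, conj ((conj z * ζ) ^ n / (monomialNormSq ω n : ℂ)) = c n * conj ζ ^ n := by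
    intro ζ n
    simp only [hc, map_div₀, map_pow, map_mul, Complex.conj_conj, Complex.conj_ofReal]
    ring
  have hbd : ∀ n, ∀ᵐ ζ ∂(weightedArea ω), ‖f ζ * (c n * conj ζ ^ n)‖ ≤ ‖c n‖ * ‖f ζ‖ := by
    intro n
    filter_upwards [ae_mem_ball] with ζ hζ
    have h1 := pow_le_one₀ (n := n) (norm_nonneg _) (by simpa using hζ : ‖ζ‖ < 1).le
    simp only [norm_mul, norm_pow, RCLike.norm_conj]
    calc _ ≤ ‖f ζ‖ * (‖c n‖ * 1) := by gcongr
      _ = _ := by ring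
  have hnint : ∀ n, Integrable (fun ζ => f ζ * (c n * conj ζ ^ n)) (weightedArea ω) := fun n =>
    (hfint.norm.const_mul ‖c n‖).mono' (hfint.aestronglyMeasurable.mul (by fun_prop)) (hbd n)
  have hS := hasSum_integral_of_summable_integral_norm hnint ?_
  · have hterm : ∀ n, ∫ ζ, f ζ * (c n * conj ζ ^ n) ∂(weightedArea ω) = a n * z ^ n := by
      intro n
      have hm : (monomialNormSq ω n : ℂ) ≠ 0 := by
        exact_mod_cast (monomialNormSq_pos hω hpos n).ne'
      simp only [mul_left_comm _ (c n)]
      rw [integral_const_mul, integral_mul_conj_pow hω hf ha n, hc]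
      simp only [ha']
      field_simp
    simp only [hterm] at hS
    rw [(ha z hz).unique hS]
    refine integral_congr_ae ?_
    filter_upwards [ae_mem_ball] with ζ hζ
    rw [tsum_mul_left, kernelSeries, Complex.conj_tsum]
    simp only [hconj]
  · refine Summable.of_nonneg_of_le (fun n => integral_nonneg fun _ => norm_nonneg _) (fun n => ?_)
      ((summable_kernel hω hpos hz).mul_right (∫ ζ, ‖f ζ‖ ∂(weightedArea ω)))
    rw [← hcn, ← integral_const_mul]
    exact integral_mono_ae (hnint n).norm (hfint.norm.const_mul _) (hbd n)

/-- The kernel used in the definitions below has the reproducing property. -/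
theorem isReproducingKernelAt_bergmanKernel (hω : IsRadialWeight ω)
    (hpos : ∀ r ∈ Ico (0 : ℝ) 1, 0 < tail ω r) {z : ℂ} (hz : z ∈ Metric.ball (0 : ℂ) 1) :
    IsReproducingKernelAt ω z (bergmanKernel ω z) :=
  Classical.epsilon_spec ⟨_, isReproducingKernelAt_kernelSeries hω hpos hz⟩

/-- The reproducing property determines the kernel on the disc. -/
theorem IsReproducingKernelAt.eqOn (hω : IsRadialWeight ω)
    (hpos : ∀ r ∈ Ico (0 : ℝ) 1, 0 < tail ω r) {z : ℂ} {K K' : ℂ → ℂ}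
    (hK : IsReproducingKernelAt ω z K) (hK' : IsReproducingKernelAt ω z K') :
    EqOn K K' (Metric.ball 0 1) := by
  have hg : MemBergman ω 2 (K - K') := ⟨hK.1.1.sub hK'.1.1, hK.1.2.sub hK'.1.2⟩
  have hmul : ∀ L : ℂ → ℂ, MemBergman ω 2 L →
      Integrable (fun ζ => (K - K') ζ * conj (L ζ)) (weightedArea ω) := fun L hL =>
    MemLp.integrable_mul hg.2 hL.2.star
  have h0 : ∫ ζ, (K - K') ζ * conj ((K - K') ζ) ∂(weightedArea ω) = 0 := by
    have h1 := (hK.2 _ hg).symm.trans (hK'.2 _ hg)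
    rw [← sub_eq_zero, ← integral_sub (hmul K hK.1) (hmul K' hK'.1)] at h1
    rw [← h1]
    congr 1 with ζ
    simp only [Pi.sub_apply, map_sub]; ring
  have h2 : ∫ ζ, ‖(K - K') ζ‖ ^ 2 ∂(weightedArea ω) = 0 := by
    have : ((∫ ζ, ‖(K - K') ζ‖ ^ 2 ∂(weightedArea ω) : ℝ) : ℂ) = 0 := by
      rw [← h0, ← integral_complex_ofReal]
      congr 1 with ζ
      rw [Complex.mul_conj, Complex.normSq_eq_norm_sq]
    exact_mod_cast this
  rw [integral_eq_zero_iff_of_nonneg (fun _ => by positivity)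
    ((memLp_two_iff_integrable_sq_norm hg.2.1).1 hg.2)] at h2
  have han : AnalyticOnNhd ℂ (K - K') (Metric.ball 0 1) := hg.1.analyticOnNhd Metric.isOpen_ball
  by_contra hne
  have hex : ∃ w ∈ Metric.ball (0 : ℂ) 1, (K - K') w ≠ 0 := by
    simp only [EqOn, not_forall] at hne
    obtain ⟨w, hw, hne⟩ := hne
    exact ⟨w, hw, by simpa [sub_eq_zero] using hne⟩
  obtain ⟨w, hw, hw0⟩ := hex
  have hcod := han.preimage_zero_mem_codiscreteWithin hw0 hw
    (Metric.isConnected_ball one_pos)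
  have hae : ∀ᵐ ζ ∂(weightedArea ω), (K - K') ζ ≠ 0 := by
    refine (withDensity_absolutelyContinuous _ _).ae_le ?_
    refine Measure.ae_smul_measure ?_ _
    exact ae_restrict_le_codiscreteWithin Metric.isOpen_ball.measurableSet hcod
  have hzero : weightedArea ω = 0 := by
    rw [← ae_eq_bot, ← Filter.eventually_false_iff_eq_bot]
    filter_upwards [h2, hae] with ζ h h' using h' (by simpa using h)
  have h4 := weightedArea_annulus_pos hω hpos (r := 1 / 2) (by norm_num)
  simp [hzero] at h4

/-- For fixed `z` in the disc the kernel is bounded on the disc. -/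
theorem norm_bergmanKernel_le (hω : IsRadialWeight ω)
    (hpos : ∀ r ∈ Ico (0 : ℝ) 1, 0 < tail ω r) {z : ℂ} (hz : z ∈ Metric.ball (0 : ℂ) 1) :
    ∃ M : ℝ, ∀ ζ ∈ Metric.ball (0 : ℂ) 1, ‖bergmanKernel ω z ζ‖ ≤ M := by
  refine ⟨∑' n : ℕ, ‖z‖ ^ n / monomialNormSq ω n, fun ζ hζ => ?_⟩
  rw [(isReproducingKernelAt_bergmanKernel hω hpos hz).eqOn hω hpos
    (isReproducingKernelAt_kernelSeries hω hpos hz) hζ]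
  exact tsum_of_norm_bounded (summable_kernel hω hpos hz).hasSum
    fun n => norm_kernel_term_le hω hpos z n hζ

end Existence

/-- The maximal Bergman projection `P⁺_ω(f)(z) = ∫ f(ζ) |B^ω_z(ζ)| ω(ζ) dA(ζ)`. -/
def maximalBergmanProjection (ω : ℝ → ℝ) (f : ℂ → ℂ) (z : ℂ) : ℂ :=
  ∫ ζ, f ζ * (‖bergmanKernel ω z ζ‖ : ℂ) ∂(weightedArea ω)

/-- `P⁺_ω : L^p_ω → L^p_ω` is bounded. For each `f ∈ L^p_ω` with `p ≥ 1` and each `z` in the disc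
the integral defining `P⁺_ω(f)(z)` converges, as kernel functions are bounded on the disc
(`norm_bergmanKernel_le`). -/
def MaximalProjectionBounded (ω : ℝ → ℝ) (p : ℝ≥0∞) : Prop :=
  ∃ C : ℝ≥0, ∀ f : ℂ → ℂ, MemLp f p (weightedArea ω) →
    MemLp (maximalBergmanProjection ω f) p (weightedArea ω) ∧
      eLpNorm (maximalBergmanProjection ω f) p (weightedArea ω)
        ≤ C * eLpNorm f p (weightedArea ω)

end RadialBergman

end

noncomputable section

namespace RadialBergman

variable {ω : ℝ → ℝ}

/-! Write `m n` for `monomialNormSq ω n`. The kernel is the power series with coefficients `1 / m n`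
evaluated at `conj z * ζ`, and `ω dA` is rotation invariant. Against radial functions, `|B_z(ζ)|`
may therefore be replaced by its average over a circle of radius `x = |z||ζ|`, so both directions
reduce to the size of `circleMean ω x`.

Sufficiency. Under two-sided doubling, `circleMean ω x ≤ L / tail ω x` (`exists_circleMean_le`). The
difference of the power series on the circles of radii `x` and `y`, with `1 - y ≤ K (1 - x)`, has
`L¹` norm `O(1 / tail ω x)` (`circleMean_le_add`). To see this, the difference is factored as a
geometric series times a series with small coefficients, and Cauchy-Schwarz and Parseval are
applied; upper doubling enters through the regular decay of `m n`. Moving towards the centre in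
steps that multiply `1 - x` by `K`, lower doubling makes these errors sum like a geometric series.
Since `tail ω` at `|z||ζ|` dominates its values at `|z|` and at `|ζ|`, and the tail has a
distribution dominated by Lebesgue measure, small negative powers of the tail pass Schur's test.

Necessity. Testing on the indicator of `{r < |z|}` shows that a lower bound for `circleMean` on
`[r², 1)` times the mass of this annulus is bounded uniformly in `r`. Hardy's inequality bounds the
circle mean below by `2 ∑ xⁿ / (n m n)`. Over `J` dyadic blocks starting at `N ≈ 1 / (1 - s)` this
is at least about `J / m N`, and upper doubling gives `m N ≲ tail ω s`. Hence `J * tail ω r ≲ tail ω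
s` when `1 - r = (1 - s) / (4 * 2 ^ J)`, and a large `J` gives lower doubling. -/

/-! ### Tail integrals and masses of annuli -/

lemma integrableOn_weight_Ioo (hω : IsRadialWeight ω) {r : ℝ} (hr : 0 ≤ r) :
    IntegrableOn ω (Ioo r 1) :=
  hω.integrable.mono_set fun _ hy => ⟨hr.trans hy.1.le, hy.2⟩

lemma tail_eq_setIntegral {r : ℝ} (hr : r ≤ 1) : tail ω r = ∫ s in Ioo r 1, ω s := by
  rw [tail, intervalIntegral.integral_of_le hr, ← restrict_Ioo_eq_restrict_Ioc]

lemma tail_one : tail ω 1 = 0 := by simp [tail]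

lemma tail_anti (hω : IsRadialWeight ω) : AntitoneOn (tail ω) (Icc 0 1) := by
  intro r hr s hs hrs
  rw [tail_eq_setIntegral hr.2, tail_eq_setIntegral hs.2]
  refine setIntegral_mono_set (integrableOn_weight_Ioo hω hr.1) ?_
    (Ioo_subset_Ioo_left hrs).eventuallyLE
  filter_upwards [ae_restrict_mem measurableSet_Ioo] with y hy
    using hω.nonneg y ⟨hr.1.trans hy.1.le, hy.2⟩

lemma tail_nonneg (hω : IsRadialWeight ω) {r : ℝ} (hr : r ∈ Icc (0 : ℝ) 1) : 0 ≤ tail ω r := by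
  rw [← tail_one (ω := ω)]
  exact tail_anti hω hr ⟨zero_le_one, le_rfl⟩ hr.2

lemma continuousOn_tail (hω : IsRadialWeight ω) : ContinuousOn (tail ω) (Icc 0 1) := by
  have h := intervalIntegral.continuousOn_primitive_interval_left (μ := volume) (f := ω)
    (a := 0) (b := 1) (by
      rw [uIcc_of_le zero_le_one, integrableOn_Icc_iff_integrableOn_Ioo]
      exact integrableOn_weight_Ioo hω le_rfl)
  rwa [uIcc_of_le zero_le_one] at h

/-- The `ω dA`-measure of a radial set. -/
lemma real_norm_preimage (hω : IsRadialWeight ω) {S : Set ℝ} (hS : MeasurableSet S) :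
    (weightedArea ω).real {z | ‖z‖ ∈ S} = 2 * ∫ y in S ∩ Ioo 0 1, y * ω y := by
  have hms : MeasurableSet {z : ℂ | ‖z‖ ∈ S} := measurable_norm hS
  have hb : MeasurableSet (Metric.ball (0 : ℂ) 1) := Metric.isOpen_ball.measurableSet
  have hint : IntegrableOn (fun z : ℂ => ω ‖z‖) ({z : ℂ | ‖z‖ ∈ S} ∩ Metric.ball 0 1) :=
    (integrable_weight hω).mono_set inter_subset_right
  have hnn : 0 ≤ᵐ[volume.restrict ({z : ℂ | ‖z‖ ∈ S} ∩ Metric.ball 0 1)] fun z => ω ‖z‖ := by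
    filter_upwards [ae_restrict_mem (hms.inter hb)] with z hz
      using hω.nonneg _ ⟨norm_nonneg _, by simpa using hz.2⟩
  rw [measureReal_def, weightedArea, withDensity_apply _ hms, normalizedArea,
    Measure.restrict_smul, lintegral_smul_measure, Measure.restrict_restrict hms,
    ← ofReal_integral_eq_lintegral_ofReal hint hnn, smul_eq_mul, ENNReal.toReal_mul,
    ENNReal.toReal_ofReal (by positivity), ENNReal.toReal_ofReal (integral_nonneg_of_ae hnn),
    ← integral_indicator (hms.inter hb)]
  have h1 : (fun z : ℂ => ({z : ℂ | ‖z‖ ∈ S} ∩ Metric.ball 0 1).indicator (fun z => ω ‖z‖) z) =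
      fun z => (S ∩ Iio 1).indicator ω ‖z‖ := by
    ext z
    by_cases h1 : ‖z‖ ∈ S <;> by_cases h2 : ‖z‖ < 1 <;> simp [indicator, h1, h2]
  rw [h1, integral_fun_norm_addHaar]
  have h2 : ∫ y in Ioi (0 : ℝ), y ^ (2 - 1) * (S ∩ Iio 1).indicator ω y =
      ∫ y in S ∩ Ioo 0 1, y * ω y := by
    have : ∀ y, y ^ (2 - 1) * (S ∩ Iio 1).indicator ω y =
        (S ∩ Iio 1).indicator (fun y => y * ω y) y := by
      intro y; by_cases hy : y ∈ S ∩ Iio 1 <;> simp [indicator, hy]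
    simp only [this]
    rw [setIntegral_indicator (hS.inter measurableSet_Iio)]
    congr 2
    ext y; simp; tauto
  have hvol : (volume : Measure ℂ).real (Metric.ball 0 1) = Real.pi := by
    simp [measureReal_def]
  simp only [Complex.finrank_real_complex, nsmul_eq_mul, smul_eq_mul, h2, hvol]
  field_simp
  push_cast
  ring

lemma integrableOn_mul_weight (hω : IsRadialWeight ω) {r : ℝ} (hr : 0 ≤ r) :
    IntegrableOn (fun y => y * ω y) (Ioo r 1) := by
  have hint := integrableOn_weight_Ioo hω hr
  refine Integrable.mono hint (measurable_id.aestronglyMeasurable.mul hint.aestronglyMeasurable) ?_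
  filter_upwards [ae_restrict_mem measurableSet_Ioo] with y hy
  have := abs_of_nonneg (hr.trans hy.1.le)
  simp only [norm_mul, Real.norm_eq_abs, this]
  exact mul_le_of_le_one_left (abs_nonneg _) hy.2.le

/-- In polar coordinates the mass has radial density `2 y ω y`; `y ≤ 1` gives this bound, and `r <
y` the reverse one in `le_real_lt_norm`. -/
lemma real_le_norm_le (hω : IsRadialWeight ω) {r : ℝ} (hr : r ∈ Icc (0 : ℝ) 1) :
    (weightedArea ω).real {z | r ≤ ‖z‖} ≤ 2 * tail ω r := by
  have h := real_norm_preimage hω (measurableSet_Ici (a := r))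
  simp only [mem_Ici] at h
  rw [h, tail_eq_setIntegral hr.2]
  gcongr 2 * ?_
  have hae : (Ici r ∩ Ioo 0 1 : Set ℝ) =ᵐ[volume] Ioo r 1 := by
    have h1 : (Ici r ∩ Ioo 0 1 : Set ℝ) =ᵐ[volume] (Ioi r ∩ Ioo 0 1 : Set ℝ) :=
      Ioi_ae_eq_Ici.symm.inter (ae_eq_refl _)
    rwa [show (Ioi r ∩ Ioo 0 1 : Set ℝ) = Ioo r 1 by
      ext y; simp only [mem_inter_iff, mem_Ioi, mem_Ioo]
      exact ⟨fun h => ⟨h.1, h.2.2⟩, fun h => ⟨h.1, hr.1.trans_lt h.1, h.2⟩⟩] at h1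
  rw [setIntegral_congr_set hae]
  refine setIntegral_mono_on (integrableOn_mul_weight hω hr.1)
    (integrableOn_weight_Ioo hω hr.1) measurableSet_Ioo fun y hy => ?_
  exact mul_le_of_le_one_left (hω.nonneg y ⟨hr.1.trans hy.1.le, hy.2⟩) hy.2.le

lemma le_real_lt_norm (hω : IsRadialWeight ω) {r : ℝ} (hr : r ∈ Icc (0 : ℝ) 1) :
    2 * r * tail ω r ≤ (weightedArea ω).real {z | r < ‖z‖} := by
  have h := real_norm_preimage hω (measurableSet_Ioi (a := r))
  simp only [mem_Ioi] at h
  rw [h, tail_eq_setIntegral hr.2, show (Ioi r ∩ Ioo 0 1 : Set ℝ) = Ioo r 1 by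
      ext y; simp only [mem_inter_iff, mem_Ioi, mem_Ioo]
      exact ⟨fun h => ⟨h.1, h.2.2⟩, fun h => ⟨h.1, hr.1.trans_lt h.1, h.2⟩⟩,
    mul_assoc, ← integral_const_mul]
  gcongr 2 * ?_
  refine setIntegral_mono_on ((integrableOn_weight_Ioo hω hr.1).const_mul r)
    (integrableOn_mul_weight hω hr.1) measurableSet_Ioo fun y hy => ?_
  exact mul_le_mul_of_nonneg_right hy.1.le (hω.nonneg y ⟨hr.1.trans hy.1.le, hy.2⟩)

/-- Since `t ≤ ((1 + t) / 2) ^ 2`, doubling from `t` to `(1 + t) / 2` stays inside `{t < ‖z‖ ^ 2}`.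
The weight `2 y` costs only a factor `2`, because `(1 + t) / 2 ≥ 1 / 2`. -/
lemma real_lt_norm_le_sq (hω : IsRadialWeight ω) {C : ℝ}
    (hC : ∀ r ∈ Ico (0 : ℝ) 1, tail ω r ≤ C * tail ω ((1 + r) / 2)) (hC0 : 0 ≤ C)
    {t : ℝ} (ht : 0 ≤ t) :
    (weightedArea ω).real {z | t < ‖z‖} ≤ 2 * C * (weightedArea ω).real {z | t < ‖z‖ ^ 2} := by
  have := isFiniteMeasure_weightedArea hω
  rcases le_or_gt 1 t with h1 | h1
  · have h0 := (measureReal_mono (μ := weightedArea ω)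
      (fun z (hz : t < ‖z‖) => (h1.trans hz.le : (1:ℝ) ≤ ‖z‖) )).trans
      (real_le_norm_le hω (r := 1) (by norm_num))
    rw [tail_one, mul_zero] at h0
    exact h0.trans (by positivity)
  have hs : (1 + t) / 2 ∈ Icc (0 : ℝ) 1 := ⟨by linarith, by linarith⟩
  calc _ ≤ (weightedArea ω).real {z | t ≤ ‖z‖} := measureReal_mono fun z (hz : t < ‖z‖) => hz.le
    _ ≤ 2 * tail ω t := real_le_norm_le hω ⟨ht, h1.le⟩
    _ ≤ 2 * (C * tail ω ((1 + t) / 2)) := by gcongr; exact hC t ⟨ht, h1⟩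
    _ = 2 * C * (1 * tail ω ((1 + t) / 2)) := by ring
    _ ≤ 2 * C * (2 * ((1 + t) / 2) * tail ω ((1 + t) / 2)) := by
        have := tail_nonneg hω hs
        gcongr; linarith
    _ ≤ 2 * C * (weightedArea ω).real {z | (1 + t) / 2 < ‖z‖} := by
        gcongr; exact le_real_lt_norm hω hs
    _ ≤ _ := by
        refine mul_le_mul_of_nonneg_left (measureReal_mono fun z hz => ?_) (by positivity)
        have hz' : (1 + t) / 2 < ‖z‖ := hz
        show t < ‖z‖ ^ 2
        nlinarith [sq_nonneg (1 - t)]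

/-! ### Moments under upper doubling -/

lemma integrable_norm_pow (hω : IsRadialWeight ω) (k : ℕ) :
    Integrable (fun z : ℂ => ‖z‖ ^ k) (weightedArea ω) := by
  refine integrable_of_bounded hω (by fun_prop) 1 fun z hz => ?_
  simpa using pow_le_one₀ (norm_nonneg _) (by simpa using hz : ‖z‖ < 1).le

/-- Upper doubling for moments. -/
lemma integral_norm_pow_le_double (hω : IsRadialWeight ω) {C : ℝ}
    (hC : ∀ r ∈ Ico (0 : ℝ) 1, tail ω r ≤ C * tail ω ((1 + r) / 2)) (hC0 : 0 ≤ C)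
    {k : ℕ} (hk : k ≠ 0) :
    ∫ z, ‖z‖ ^ k ∂(weightedArea ω) ≤ 2 * C * ∫ z, ‖z‖ ^ (2 * k) ∂(weightedArea ω) := by
  have := isFiniteMeasure_weightedArea hω
  -- Layer-cake formula: with `s` the `k`-th root of the level `t`, the two superlevel sets are
  -- those compared in `real_lt_norm_le_sq`.
  have key : ∫⁻ z, ENNReal.ofReal (‖z‖ ^ k) ∂(weightedArea ω) ≤
      ENNReal.ofReal (2 * C) * ∫⁻ z, ENNReal.ofReal (‖z‖ ^ (2 * k)) ∂(weightedArea ω) := by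
    rw [lintegral_eq_lintegral_meas_lt _ (Eventually.of_forall fun z => by positivity)
      (by fun_prop), lintegral_eq_lintegral_meas_lt _ (Eventually.of_forall fun z => by positivity)
      (by fun_prop), ← lintegral_const_mul' _ _ ENNReal.ofReal_ne_top]
    refine setLIntegral_mono' measurableSet_Ioi fun t ht => ?_
    have ht0 : 0 ≤ t := le_of_lt ht
    set s := t ^ ((k : ℝ)⁻¹) with hs
    have hs0 : 0 ≤ s := Real.rpow_nonneg ht0 _
    have hsk : s ^ k = t := Real.rpow_inv_natCast_pow ht0 hk
    have e1 : {z : ℂ | t < ‖z‖ ^ k} = {z | s < ‖z‖} := by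
      ext z; rw [mem_ofPred_eq, ← hsk, pow_lt_pow_iff_left₀ hs0 (norm_nonneg _) hk]; rfl
    have e2 : {z : ℂ | t < ‖z‖ ^ (2 * k)} = {z | s < ‖z‖ ^ 2} := by
      ext z; rw [mem_ofPred_eq, ← hsk, pow_mul, pow_lt_pow_iff_left₀ hs0 (by positivity) hk]; rfl
    rw [e1, e2, ← ofReal_measureReal, ← ofReal_measureReal, ← ENNReal.ofReal_mul (by positivity)]
    exact ENNReal.ofReal_le_ofReal (real_lt_norm_le_sq hω hC hC0 hs0)
  rw [← ofReal_integral_eq_lintegral_ofReal (integrable_norm_pow hω k)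
      (Eventually.of_forall fun z => by positivity),
    ← ofReal_integral_eq_lintegral_ofReal (integrable_norm_pow hω _)
      (Eventually.of_forall fun z => by positivity), ← ENNReal.ofReal_mul (by positivity)] at key
  exact (ENNReal.ofReal_le_ofReal_iff
    (mul_nonneg (by positivity) (integral_nonneg fun z => by positivity))).1 key

lemma integral_norm_pow_le_two_pow_mul (hω : IsRadialWeight ω) {C : ℝ}
    (hC : ∀ r ∈ Ico (0 : ℝ) 1, tail ω r ≤ C * tail ω ((1 + r) / 2)) (hC0 : 0 ≤ C)
    {k : ℕ} (hk : k ≠ 0) (j : ℕ) :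
    ∫ z, ‖z‖ ^ k ∂(weightedArea ω) ≤
      (2 * C) ^ j * ∫ z, ‖z‖ ^ (2 ^ j * k) ∂(weightedArea ω) := by
  induction j with
  | zero => simp
  | succ j ih =>
    refine ih.trans ?_
    rw [pow_succ, mul_assoc]
    gcongr
    have := integral_norm_pow_le_double hω hC hC0 (k := 2 ^ j * k) (by positivity)
    rwa [← mul_assoc, ← pow_succ'] at this

lemma integral_norm_pow_anti (hω : IsRadialWeight ω) {k l : ℕ} (h : k ≤ l) :
    ∫ z, ‖z‖ ^ l ∂(weightedArea ω) ≤ ∫ z, ‖z‖ ^ k ∂(weightedArea ω) := by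
  refine integral_mono_ae (integrable_norm_pow hω l) (integrable_norm_pow hω k) ?_
  filter_upwards [ae_mem_ball] with z hz
  exact pow_le_pow_of_le_one (norm_nonneg _) (by simpa using hz : ‖z‖ < 1).le h

lemma monomialNormSq_anti (hω : IsRadialWeight ω) : Antitone (monomialNormSq ω) :=
  fun _ _ h => integral_norm_pow_anti hω (by omega)

/-- The moments decay regularly: consecutive differences are `O(m_n / n)`. -/
lemma mul_monomialNormSq_sub_le (hω : IsRadialWeight ω) {C : ℝ}
    (hC : ∀ r ∈ Ico (0 : ℝ) 1, tail ω r ≤ C * tail ω ((1 + r) / 2)) (hC0 : 0 ≤ C) (n : ℕ) :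
    n * (monomialNormSq ω n - monomialNormSq ω (n + 1)) ≤
      2 * (2 * C) ^ 2 * monomialNormSq ω (n + 1) := by
  rcases Nat.eq_zero_or_pos n with rfl | hn
  · simp only [Nat.cast_zero, zero_mul]
    exact mul_nonneg (by positivity) (integral_nonneg fun z => by positivity)
  -- The integrand is `n (1 - ‖z‖) ‖z‖ ^ n` times `(1 + ‖z‖) ‖z‖ ^ n`; the first factor is at most
  -- `1` by the geometric sum.
  have h1 : n * (monomialNormSq ω n - monomialNormSq ω (n + 1)) ≤
      2 * ∫ z, ‖z‖ ^ n ∂(weightedArea ω) := by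
    rw [monomialNormSq, monomialNormSq, ← integral_sub (integrable_norm_pow hω _)
      (integrable_norm_pow hω _), ← integral_const_mul, ← integral_const_mul]
    refine integral_mono_ae (((integrable_norm_pow hω _).sub
      (integrable_norm_pow hω _)).const_mul _) ((integrable_norm_pow hω _).const_mul _) ?_
    filter_upwards [ae_mem_ball] with z hz
    have hz1 : ‖z‖ < 1 := by simpa using hz
    have hz0 := norm_nonneg z
    have h2 : (n : ℝ) * ((1 - ‖z‖) * ‖z‖ ^ n) ≤ 1 := by
      have h3 : (n : ℝ) * ‖z‖ ^ n ≤ ∑ i ∈ Finset.range n, ‖z‖ ^ i := by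
        have := Finset.card_nsmul_le_sum (Finset.range n) (fun i => ‖z‖ ^ i) (‖z‖ ^ n)
          fun i hi => pow_le_pow_of_le_one hz0 hz1.le (Finset.mem_range.1 hi).le
        simpa using this
      have h4 := mul_neg_geom_sum ‖z‖ n
      have h5 : 0 ≤ ‖z‖ ^ n := by positivity
      nlinarith
    calc (n : ℝ) * (‖z‖ ^ (2 * n) - ‖z‖ ^ (2 * (n + 1)))
        = (n * ((1 - ‖z‖) * ‖z‖ ^ n)) * ((1 + ‖z‖) * ‖z‖ ^ n) := by ring
      _ ≤ 1 * (2 * ‖z‖ ^ n) := by gcongr; linarith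
      _ = _ := one_mul _
  -- Two doublings take the exponent from `n` to `4 n ≥ 2 (n + 1)`, as `n ≥ 1`.
  have h2 := integral_norm_pow_le_two_pow_mul hω hC hC0 hn.ne' 2
  have h3 : ∫ z, ‖z‖ ^ (2 ^ 2 * n) ∂(weightedArea ω) ≤ monomialNormSq ω (n + 1) :=
    integral_norm_pow_anti hω (by omega)
  calc _ ≤ _ := h1
    _ ≤ 2 * ((2 * C) ^ 2 * monomialNormSq ω (n + 1)) := by gcongr; exact h2.trans (by gcongr)
    _ = _ := by ring

/-! ### Absolutely convergent trigonometric series: Parseval, an `L¹` bound, Hardy's inequality -/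

section CircleIntegrals

open Complex (I)

lemma norm_exp_mul_I_pow (θ : ℝ) (n : ℕ) : ‖Complex.exp (θ * I) ^ n‖ = 1 := by
  rw [norm_pow, Complex.norm_exp_ofReal_mul_I, one_pow]

lemma continuous_tsum_mul_exp {c : ℕ → ℂ} (hc : Summable fun n => ‖c n‖) :
    Continuous fun θ : ℝ => ∑' n, c n * Complex.exp (θ * I) ^ n :=
  continuous_tsum (fun n => by fun_prop) hc fun n θ => by
    rw [norm_mul, norm_exp_mul_I_pow, mul_one]

lemma summable_mul_exp {c : ℕ → ℂ} (hc : Summable fun n => ‖c n‖) (θ : ℝ) :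
    Summable fun n => c n * Complex.exp (θ * I) ^ n :=
  Summable.of_norm <| by simpa only [norm_mul, norm_exp_mul_I_pow, mul_one] using hc

/-- Term-by-term integration of an absolutely convergent trigonometric series. -/
lemma hasSum_integral_mul_tsum_exp {c : ℕ → ℂ} (hc : Summable fun n => ‖c n‖) {g : ℝ → ℂ}
    (hg : Continuous g) :
    HasSum (fun n => c n * ∫ θ in (0)..(2 * Real.pi), g θ * Complex.exp (θ * I) ^ n)
      (∫ θ in (0)..(2 * Real.pi), g θ * ∑' n, c n * Complex.exp (θ * I) ^ n) := by
  have h := intervalIntegral.hasSum_integral_of_dominated_convergence (μ := volume)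
    (a := 0) (b := 2 * Real.pi)
    (F := fun n (θ : ℝ) => g θ * (c n * Complex.exp (θ * I) ^ n))
    (f := fun θ : ℝ => g θ * ∑' n, c n * Complex.exp (θ * I) ^ n)
    (fun n θ => ‖g θ‖ * ‖c n‖)
    (fun n => Continuous.aestronglyMeasurable (by fun_prop))
    (fun n => Eventually.of_forall fun θ _ => by
      rw [norm_mul, norm_mul, norm_exp_mul_I_pow, mul_one])
    (Eventually.of_forall fun θ _ => hc.mul_left _)
    (by
      simp only [tsum_mul_left]
      exact Continuous.intervalIntegrable (by fun_prop) _ _)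
    (Eventually.of_forall fun θ _ => (summable_mul_exp hc θ).hasSum.mul_left _)
  refine h.congr_fun fun n => ?_
  rw [← intervalIntegral.integral_const_mul]
  congr 1 with θ
  ring

lemma integral_exp_pow_mul_conj (k n : ℕ) :
    ∫ θ in (0)..(2 * Real.pi), conj (Complex.exp (θ * I) ^ n) * Complex.exp (θ * I) ^ k =
      if k = n then 2 * (Real.pi : ℂ) else 0 := by
  have h : ∀ θ : ℝ, conj (Complex.exp (θ * I) ^ n) * Complex.exp (θ * I) ^ k =
      Complex.exp (((k : ℂ) - n) * I * θ) := by
    intro θ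
    rw [map_pow, ← Complex.exp_conj, ← Complex.exp_nat_mul, ← Complex.exp_nat_mul,
      ← Complex.exp_add]
    congr 1
    simp only [map_mul, Complex.conj_I, Complex.conj_ofReal]
    ring
  simp only [h]
  split_ifs with hkn
  · simp [hkn]
  · have h0 : ((k : ℂ) - n) * I ≠ 0 :=
      mul_ne_zero (sub_ne_zero.2 (by exact_mod_cast hkn)) Complex.I_ne_zero
    rw [integral_exp_mul_complex h0]
    have h1 : Complex.exp (((k : ℂ) - n) * I * ((2 * Real.pi : ℝ) : ℂ)) = 1 := by
      rw [Complex.exp_eq_one_iff]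
      exact ⟨(k : ℤ) - n, by push_cast; ring⟩
    rw [h1]
    simp

/-- Parseval's identity for absolutely convergent one-sided trigonometric series. -/
lemma integral_norm_sq_tsum_exp {c : ℕ → ℂ} (hc : Summable fun n => ‖c n‖) :
    HasSum (fun n => 2 * Real.pi * ‖c n‖ ^ 2)
      (∫ θ in (0)..(2 * Real.pi), ‖∑' n, c n * Complex.exp ((θ : ℝ) * I) ^ n‖ ^ 2) := by
  set f : ℝ → ℂ := fun θ => ∑' n, c n * Complex.exp (θ * I) ^ n with hf
  have hfc : Continuous f := continuous_tsum_mul_exp hc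
  have h1 : ∀ n, ∫ θ in (0)..(2 * Real.pi), conj (Complex.exp (θ * I) ^ n) * f θ =
      c n * (2 * (Real.pi : ℂ)) := by
    intro n
    have h := hasSum_integral_mul_tsum_exp hc
      (g := fun θ : ℝ => conj (Complex.exp (θ * I) ^ n)) (by fun_prop)
    simp only [integral_exp_pow_mul_conj] at h
    refine h.unique ?_
    convert hasSum_ite_eq n (c n * (2 * (Real.pi : ℂ))) using 2 with k
    split_ifs with hk
    · rw [hk]
    · simp
  have h2 : ∀ n, ∫ θ in (0)..(2 * Real.pi), conj (f θ) * Complex.exp (θ * I) ^ n =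
      conj (c n) * (2 * (Real.pi : ℂ)) := by
    intro n
    have h := congrArg conj (h1 n)
    rw [← intervalIntegral.intervalIntegral_conj] at h
    simpa only [map_mul, Complex.conj_conj, Complex.conj_ofReal, Complex.conj_ofNat,
      mul_comm (conj (f _))] using h
  have h3 := hasSum_integral_mul_tsum_exp hc (g := fun θ => conj (f θ)) (by fun_prop)
  simp only [h2] at h3
  have h4 : ∀ θ, conj (f θ) * f θ = ((‖f θ‖ ^ 2 : ℝ) : ℂ) := fun θ => by
    rw [mul_comm, Complex.mul_conj, Complex.normSq_eq_norm_sq]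
  have h5 : ∀ n, c n * (conj (c n) * (2 * (Real.pi : ℂ))) = ((2 * Real.pi * ‖c n‖ ^ 2 : ℝ) : ℂ) := by
    intro n
    rw [← mul_assoc, Complex.mul_conj, Complex.normSq_eq_norm_sq]
    push_cast; ring
  change HasSum _ (∫ θ in (0)..(2 * Real.pi), conj (f θ) * f θ) at h3
  simp only [h4, h5] at h3
  rw [intervalIntegral.integral_ofReal] at h3
  exact_mod_cast h3

/-- An `L¹` bound for a trigonometric series from the size of the twisted differences
`c (n + 1) - x * c n` of its coefficients. -/
lemma integral_norm_tsum_exp_le {c : ℕ → ℂ} (hc : Summable fun n => ‖c n‖) (h0 : c 0 = 0)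
    {x Q : ℝ} (hx0 : 0 ≤ x) (hx1 : x < 1) (hQ : 0 < Q)
    (hd : ∀ n, ‖c (n + 1) - x * c n‖ ^ 2 ≤ (Q * (1 - x)) ^ 2 * x ^ n) :
    ∫ θ in (0)..(2 * Real.pi), ‖∑' n, c n * Complex.exp ((θ : ℝ) * I) ^ n‖ ≤
      2 * Real.pi * Q := by
  have hpi := Real.pi_pos
  have hx' : 0 < 1 - x := sub_pos.2 hx1
  set f : ℝ → ℂ := fun θ => ∑' n, c n * Complex.exp (θ * I) ^ n with hf
  set d : ℕ → ℂ := fun n => c (n + 1) - x * c n with hdd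
  have hc1 : Summable fun n => ‖c (n + 1)‖ := (summable_nat_add_iff 1).2 hc
  have hds : Summable fun n => ‖d n‖ := by
    refine Summable.of_nonneg_of_le (fun n => norm_nonneg _) (fun n => norm_sub_le _ _)
      (hc1.add ?_)
    simpa only [norm_mul] using hc.mul_left ‖(x : ℂ)‖
  set h : ℝ → ℂ := fun θ => ∑' n, ((x : ℂ) ^ n) * Complex.exp (θ * I) ^ n with hh
  have hxs : Summable fun n : ℕ => ‖(x : ℂ) ^ n‖ := by
    simpa [abs_of_nonneg hx0] using summable_geometric_of_lt_one hx0 hx1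
  set g : ℝ → ℂ := fun θ => ∑' n, d n * Complex.exp (θ * I) ^ n with hg
  -- Multiplying `f` by `1 - x e` turns its coefficients into twisted differences shifted by one; `c
  -- 0 = 0` kills the boundary term. Dividing back introduces the geometric series `h`.
  have hgf : ∀ θ, ‖f θ‖ = ‖g θ‖ * ‖h θ‖ := by
    intro θ
    set e := Complex.exp (θ * I) with he
    have hen : ‖e‖ = 1 := Complex.norm_exp_ofReal_mul_I θ
    have hxe : ‖(x : ℂ) * e‖ < 1 := by
      rw [norm_mul, hen, mul_one, Complex.norm_real, Real.norm_eq_abs, abs_of_nonneg hx0]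
      exact hx1
    have e1 : h θ = (1 - x * e)⁻¹ := by
      rw [← tsum_geometric_of_norm_lt_one hxe]
      simp only [hh, mul_pow]
      rfl
    have e2 : f θ = e * ∑' n, c (n + 1) * e ^ n := by
      have := (summable_mul_exp hc θ).tsum_eq_zero_add
      simp only [h0, zero_mul, zero_add] at this
      simp only [hf]
      rw [this, ← tsum_mul_left]
      congr 1 with n
      rw [← he]; ring
    have e3 : e * g θ = (1 - x * e) * f θ := by
      have : g θ = ∑' n, c (n + 1) * e ^ n - x * f θ := by
        simp only [hg, hf, hdd]
        rw [← tsum_mul_left, ← (summable_mul_exp hc1 θ).tsum_sub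
          ((summable_mul_exp hc θ).mul_left _)]
        congr 1 with n
        rw [← he]; ring
      rw [this, mul_sub, ← e2]; ring
    have hne : (1 - x * e) ≠ 0 := by
      intro h0
      rw [sub_eq_zero] at h0
      rw [← h0] at hxe
      simp at hxe
    have e4 : f θ = e * g θ * h θ := by
      rw [e3, e1]; field_simp
    rw [e4, norm_mul, norm_mul, hen, one_mul]
  have hgc : Continuous g := continuous_tsum_mul_exp hds
  have hhc : Continuous h := continuous_tsum_mul_exp hxs
  have hfc : Continuous f := continuous_tsum_mul_exp hc
  have hG : ∫ θ in (0)..(2 * Real.pi), ‖g θ‖ ^ 2 ≤ 2 * Real.pi * (Q ^ 2 * (1 - x)) := by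
    have hs := ((hasSum_geometric_of_lt_one hx0 hx1).mul_left ((Q * (1 - x)) ^ 2)).mul_left
      (2 * Real.pi)
    refine (hasSum_le (fun n => ?_) (integral_norm_sq_tsum_exp hds) hs).trans (le_of_eq ?_)
    · exact mul_le_mul_of_nonneg_left (hd n) (by positivity)
    · field_simp
  have hH : ∫ θ in (0)..(2 * Real.pi), ‖h θ‖ ^ 2 ≤ 2 * Real.pi * (1 - x)⁻¹ := by
    have hs := (hasSum_geometric_of_lt_one hx0 hx1).mul_left (2 * Real.pi)
    refine hasSum_le (fun n => ?_) (integral_norm_sq_tsum_exp hxs) hs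
    gcongr
    rw [norm_pow, Complex.norm_real, Real.norm_eq_abs, abs_of_nonneg hx0]
    exact pow_le_of_le_one (by positivity) (pow_le_one₀ hx0 hx1.le) two_ne_zero
  -- Cauchy-Schwarz in the form of a weighted Young inequality. The weight `Q (1 - x)` balances `hG`
  -- against `hH`, each contributing `π Q`.
  calc _ ≤ ∫ θ in (0)..(2 * Real.pi),
        ((2 * (Q * (1 - x)))⁻¹ * ‖g θ‖ ^ 2 + (Q * (1 - x)) / 2 * ‖h θ‖ ^ 2) := by
        refine intervalIntegral.integral_mono_on (by positivity)
          (hfc.norm.intervalIntegrable _ _)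
          (Continuous.intervalIntegrable (by fun_prop) _ _) fun θ _ => ?_
        rw [hgf]
        set s := Q * (1 - x) with hs
        have hs0 : 0 < s := by positivity
        have : (2 * s)⁻¹ * ‖g θ‖ ^ 2 + s / 2 * ‖h θ‖ ^ 2 - ‖g θ‖ * ‖h θ‖ =
            (2 * s)⁻¹ * (‖g θ‖ - s * ‖h θ‖) ^ 2 := by field_simp; ring
        have h2 : 0 ≤ (2 * s)⁻¹ * (‖g θ‖ - s * ‖h θ‖) ^ 2 := by positivity
        linarith
    _ = (2 * (Q * (1 - x)))⁻¹ * (∫ θ in (0)..(2 * Real.pi), ‖g θ‖ ^ 2) +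
        (Q * (1 - x)) / 2 * ∫ θ in (0)..(2 * Real.pi), ‖h θ‖ ^ 2 := by
        rw [intervalIntegral.integral_add (Continuous.intervalIntegrable (by fun_prop) _ _)
          (Continuous.intervalIntegrable (by fun_prop) _ _),
          intervalIntegral.integral_const_mul, intervalIntegral.integral_const_mul]
    _ ≤ (2 * (Q * (1 - x)))⁻¹ * (2 * Real.pi * (Q ^ 2 * (1 - x))) +
        (Q * (1 - x)) / 2 * (2 * Real.pi * (1 - x)⁻¹) := by gcongr
    _ = _ := by field_simp; ring

/-- The sawtooth is the multiplier behind Hardy's inequality: it is bounded by `π` on the period and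
its coefficients are multiples of `1 / n`. An antiderivative `G` comes from integration by parts; at
`n = 0` both sides vanish, with `1 / 0 = 0`. -/
lemma integral_sawtooth_mul_exp_pow (n : ℕ) :
    ∫ θ in (0)..(2 * Real.pi), ((Real.pi - θ : ℝ) : ℂ) * Complex.exp (θ * I) ^ n =
      2 * Real.pi * I / n := by
  rcases Nat.eq_zero_or_pos n with rfl | hn
  · simp only [pow_zero, mul_one, Nat.cast_zero, div_zero]
    rw [intervalIntegral.integral_ofReal, intervalIntegral.integral_sub
      (by simp) (by simp)]
    simp
    ring
  have hn0 : (n : ℂ) ≠ 0 := by exact_mod_cast hn.ne'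
  set G : ℝ → ℂ := fun θ => ((Real.pi : ℂ) - θ) * Complex.exp (n * I * θ) / (n * I) +
    Complex.exp (n * I * θ) / (n * I) ^ 2 with hG
  have hd : ∀ θ : ℝ, HasDerivAt G (((Real.pi - θ : ℝ) : ℂ) * Complex.exp (θ * I) ^ n) θ := by
    intro θ
    have h1 : HasDerivAt (fun θ : ℝ => (θ : ℂ)) 1 θ := Complex.ofRealCLM.hasDerivAt
    have h2 : HasDerivAt (fun θ : ℝ => Complex.exp (n * I * θ))
        (Complex.exp (n * I * θ) * (n * I * 1)) θ := (h1.const_mul (n * I)).cexp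
    have h3 := (((h1.const_sub (Real.pi : ℂ)).mul h2).div_const (n * I)).add
      (h2.div_const ((n * I) ^ 2))
    refine h3.congr_deriv ?_
    rw [← Complex.exp_nat_mul, show (n : ℂ) * (θ * I) = n * I * θ by ring]
    have := Complex.I_ne_zero
    field_simp
    push_cast
    ring
  rw [intervalIntegral.integral_eq_sub_of_hasDerivAt (fun θ _ => hd θ)
    (Continuous.intervalIntegrable (by fun_prop) _ _)]
  have h1 : Complex.exp ((n : ℂ) * I * ((2 * Real.pi : ℝ) : ℂ)) = 1 := by
    rw [Complex.exp_eq_one_iff]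
    exact ⟨n, by push_cast; ring⟩
  simp only [hG, h1]
  have := Complex.I_ne_zero
  field_simp
  push_cast
  simp
  ring

/-- Hardy's inequality for series with nonnegative coefficients. -/
lemma sum_div_le_integral_norm_tsum_exp {c : ℕ → ℝ} (hc : Summable c) (hc0 : ∀ n, 0 ≤ c n)
    (s : Finset ℕ) :
    2 * ∑ n ∈ s, c n / n ≤
      ∫ θ in (0)..(2 * Real.pi), ‖∑' n, (c n : ℂ) * Complex.exp ((θ : ℝ) * I) ^ n‖ := by
  have hpi := Real.pi_pos
  have hcn : Summable fun n => ‖(c n : ℂ)‖ := by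
    simpa only [Complex.norm_real, Real.norm_eq_abs, abs_of_nonneg (hc0 _)] using hc
  set f : ℝ → ℂ := fun θ => ∑' n, (c n : ℂ) * Complex.exp (θ * I) ^ n with hf
  have hfc : Continuous f := continuous_tsum_mul_exp hcn
  have h := hasSum_integral_mul_tsum_exp hcn
    (g := fun θ : ℝ => ((Real.pi - θ : ℝ) : ℂ)) (by fun_prop)
  simp only [integral_sawtooth_mul_exp_pow] at h
  -- Normalising by `2 π i` leaves the series of `c n / n`, whose `n = 0` term is `0` by the
  -- convention on division.
  have h1 := (h.mul_left (2 * Real.pi * I)⁻¹)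
  have h2 : ∀ n : ℕ, (2 * Real.pi * I)⁻¹ * ((c n : ℂ) * (2 * Real.pi * I / n)) =
      ((c n / n : ℝ) : ℂ) := by
    intro n
    have := Complex.I_ne_zero
    have : (Real.pi : ℂ) ≠ 0 := by exact_mod_cast hpi.ne'
    push_cast
    field_simp
  simp only [h2] at h1
  have h3 := Complex.hasSum_re h1
  simp only [Complex.ofReal_re] at h3
  have h4 := sum_le_hasSum s (fun n _ => div_nonneg (hc0 n) (Nat.cast_nonneg n)) h3
  have h5 : ‖∫ θ in (0)..(2 * Real.pi), ((Real.pi - θ : ℝ) : ℂ) * f θ‖ ≤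
      ∫ θ in (0)..(2 * Real.pi), Real.pi * ‖f θ‖ := by
    refine (intervalIntegral.norm_integral_le_integral_norm (by positivity)).trans ?_
    refine intervalIntegral.integral_mono_on (by positivity)
      (Continuous.intervalIntegrable (by fun_prop) _ _)
      (Continuous.intervalIntegrable (by fun_prop) _ _) fun θ hθ => ?_
    rw [norm_mul, Complex.norm_real, Real.norm_eq_abs]
    gcongr
    rw [abs_le]; constructor <;> linarith [hθ.1, hθ.2]
  rw [intervalIntegral.integral_const_mul] at h5
  have h6 := (Complex.re_le_norm _).trans_eq
    (norm_mul (2 * Real.pi * I)⁻¹ (∫ θ in (0)..(2 * Real.pi), ((Real.pi - θ : ℝ) : ℂ) * f θ))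
  have h7 : ‖(2 * Real.pi * I : ℂ)⁻¹‖ = (2 * Real.pi)⁻¹ := by
    simp [abs_of_pos hpi]
  rw [h7] at h6
  have h8 : (2 * Real.pi)⁻¹ * ‖∫ θ in (0)..(2 * Real.pi), ((Real.pi - θ : ℝ) : ℂ) * f θ‖ ≤
      (2 * Real.pi)⁻¹ * (Real.pi * ∫ θ in (0)..(2 * Real.pi), ‖f θ‖) := by gcongr
  have h9 : (2 * Real.pi)⁻¹ * (Real.pi * ∫ θ in (0)..(2 * Real.pi), ‖f θ‖) =
      (∫ θ in (0)..(2 * Real.pi), ‖f θ‖) / 2 := by field_simp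
  linarith [h4.trans (h6.trans h8)]

end CircleIntegrals

/-! ### Circle means of the kernel -/

/-- The power series with `B^ω_z(ζ) = kernelPowerSeries ω (conj z * ζ)`. -/
def kernelPowerSeries (ω : ℝ → ℝ) (w : ℂ) : ℂ := ∑' n : ℕ, w ^ n / monomialNormSq ω n

/-- The integral of `|kernelPowerSeries|` over the circle of radius `x`. -/
def circleMean (ω : ℝ → ℝ) (x : ℝ) : ℝ :=
  ∫ θ in (0)..(2 * Real.pi), ‖kernelPowerSeries ω (x * Complex.exp (θ * Complex.I))‖

lemma summable_pow_div (hω : IsRadialWeight ω)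
    (hpos : ∀ r ∈ Ico (0 : ℝ) 1, 0 < tail ω r) {x : ℝ} (hx : x ∈ Ico (0 : ℝ) 1) :
    Summable fun n : ℕ => x ^ n / monomialNormSq ω n := by
  have := summable_kernel hω hpos (z := (x : ℂ)) (by simp [abs_of_nonneg hx.1, hx.2])
  simpa [abs_of_nonneg hx.1] using this

lemma kernelPowerSeries_mul_exp (x θ : ℝ) :
    kernelPowerSeries ω (x * Complex.exp (θ * Complex.I)) =
      ∑' n : ℕ, ((x ^ n / monomialNormSq ω n : ℝ) : ℂ) * Complex.exp (θ * Complex.I) ^ n := by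
  rw [kernelPowerSeries]
  congr 1 with n
  push_cast
  ring

lemma summable_norm_pow_div (hω : IsRadialWeight ω)
    (hpos : ∀ r ∈ Ico (0 : ℝ) 1, 0 < tail ω r) {x : ℝ} (hx : x ∈ Ico (0 : ℝ) 1) :
    Summable fun n : ℕ => ‖((x ^ n / monomialNormSq ω n : ℝ) : ℂ)‖ := by
  have h0 : ∀ n, 0 ≤ x ^ n / monomialNormSq ω n := fun n =>
    div_nonneg (pow_nonneg hx.1 n) (monomialNormSq_pos hω hpos n).le
  simpa only [Complex.norm_real, Real.norm_eq_abs, abs_of_nonneg (h0 _)] using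
    summable_pow_div hω hpos hx

lemma continuous_kernelPowerSeries_mul_exp (hω : IsRadialWeight ω)
    (hpos : ∀ r ∈ Ico (0 : ℝ) 1, 0 < tail ω r) {x : ℝ} (hx : x ∈ Ico (0 : ℝ) 1) :
    Continuous fun θ : ℝ => kernelPowerSeries ω (x * Complex.exp (θ * Complex.I)) := by
  simp only [kernelPowerSeries_mul_exp]
  exact continuous_tsum_mul_exp (summable_norm_pow_div hω hpos hx)

lemma sum_pow_div_le_circleMean (hω : IsRadialWeight ω)
    (hpos : ∀ r ∈ Ico (0 : ℝ) 1, 0 < tail ω r) {x : ℝ} (hx : x ∈ Ico (0 : ℝ) 1) (s : Finset ℕ) :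
    2 * ∑ n ∈ s, x ^ n / monomialNormSq ω n / n ≤ circleMean ω x := by
  have h0 : ∀ n, 0 ≤ x ^ n / monomialNormSq ω n := fun n =>
    div_nonneg (pow_nonneg hx.1 n) (monomialNormSq_pos hω hpos n).le
  simp only [circleMean, kernelPowerSeries_mul_exp]
  exact sum_div_le_integral_norm_tsum_exp (summable_pow_div hω hpos hx) h0 s

lemma circleMean_zero (hω : IsRadialWeight ω)
    (hpos : ∀ r ∈ Ico (0 : ℝ) 1, 0 < tail ω r) :
    circleMean ω 0 = 2 * Real.pi / monomialNormSq ω 0 := by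
  have h : kernelPowerSeries ω 0 = ((1 / monomialNormSq ω 0 : ℝ) : ℂ) := by
    rw [kernelPowerSeries, tsum_eq_single 0 fun n hn => by simp [hn]]
    simp
  have hm := monomialNormSq_pos hω hpos 0
  simp only [circleMean, Complex.ofReal_zero, zero_mul, h, Complex.norm_real, Real.norm_eq_abs,
    abs_of_pos (one_div_pos.2 hm), intervalIntegral.integral_const, smul_eq_mul]
  ring

/-- The Maclaurin coefficients of the kernel are controlled by the tail. -/
lemma sq_pow_div_monomialNormSq_le (hω : IsRadialWeight ω)
    (hpos : ∀ r ∈ Ico (0 : ℝ) 1, 0 < tail ω r) {C : ℝ}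
    (hC : ∀ r ∈ Ico (0 : ℝ) 1, tail ω r ≤ C * tail ω ((1 + r) / 2)) (hC0 : 0 ≤ C)
    {x : ℝ} (hx : x ∈ Ico (0 : ℝ) 1) (n : ℕ) :
    (x ^ n / monomialNormSq ω (n + 1)) ^ 2 ≤ (2 * C ^ 3 / tail ω x) ^ 2 * x ^ n := by
  have := isFiniteMeasure_weightedArea hω
  -- Three halvings of the distance to the boundary, whence `C ^ 3`. Bernoulli gives `x ≤ t ^ 8`, so
  -- one of the two factors `x ^ n` absorbs the loss `t ^ (4 n)` from the squared moment, and the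
  -- other survives.
  set t : ℝ := 1 - (1 - x) / 8 with ht
  have ht1 : t ∈ Ico (0 : ℝ) 1 := ⟨by rw [ht]; linarith [hx.1], by rw [ht]; linarith [hx.2]⟩
  have ht78 : 7 / 8 ≤ t := by rw [ht]; linarith [hx.1]
  have htx : x ≤ t ^ 8 := by
    have := one_add_mul_le_pow (a := -(1 - x) / 8) (by linarith [hx.1]) 8
    have e : 1 + -(1 - x) / 8 = t := by rw [ht]; ring
    rw [e] at this
    push_cast at this
    linarith
  have hTx := hpos x hx
  have hTt := hpos t ht1
  have hdoub : tail ω x ≤ C ^ 3 * tail ω t := by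
    have h1 := hC x hx
    have h2 := hC ((1 + x) / 2) ⟨by linarith [hx.1], by linarith [hx.2]⟩
    have h3 := hC ((1 + (1 + x) / 2) / 2) ⟨by linarith [hx.1], by linarith [hx.2]⟩
    have e : (1 + (1 + (1 + x) / 2) / 2) / 2 = t := by rw [ht]; ring
    rw [e] at h3
    calc _ ≤ _ := h1
      _ ≤ C * (C * (C * tail ω t)) := by gcongr; exact h2.trans (by gcongr)
      _ = _ := by ring
  have hmass : tail ω t ≤ (weightedArea ω).real {z | t < ‖z‖ ∧ ‖z‖ < 1} := by
    have h1 := le_real_lt_norm hω ⟨ht1.1, ht1.2.le⟩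
    have h2 : (weightedArea ω).real {z | t < ‖z‖} =
        (weightedArea ω).real {z | t < ‖z‖ ∧ ‖z‖ < 1} := by
      refine measureReal_congr ?_
      filter_upwards [ae_mem_ball] with z hz
      have hz1 : ‖z‖ < 1 := by simpa using hz
      exact propext ⟨fun h => ⟨h, hz1⟩, fun h => h.1⟩
    rw [← h2]
    nlinarith
  have hm : t ^ (2 * (n + 1)) * tail ω t ≤ monomialNormSq ω (n + 1) :=
    le_trans (by have := ht1.1; gcongr) (le_monomialNormSq hω ht1 (n + 1))
  have ht0 : 0 < t := by linarith
  have hm0 := monomialNormSq_pos hω hpos (n + 1)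
  have hxn : 0 ≤ x ^ n := pow_nonneg hx.1 n
  have h1 : x ^ n * x ^ n ≤ x ^ n * (t ^ 4) ^ n := by
    have h84 : t ^ 8 ≤ t ^ 4 := pow_le_pow_of_le_one ht0.le ht1.2.le (by norm_num)
    exact mul_le_mul_of_nonneg_left (pow_le_pow_left₀ hx.1 (htx.trans h84) n) hxn
  have ht4 : 1 / 4 ≤ t ^ 4 := by
    calc (1 / 4 : ℝ) ≤ (7 / 8) ^ 4 := by norm_num
      _ ≤ t ^ 4 := by gcongr
  calc (x ^ n / monomialNormSq ω (n + 1)) ^ 2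
      ≤ (x ^ n / (t ^ (2 * (n + 1)) * tail ω t)) ^ 2 := by gcongr
    _ = (x ^ n * x ^ n) / ((t ^ 4) ^ n * t ^ 4 * tail ω t ^ 2) := by
        rw [div_pow, sq (x ^ n)]; ring_nf
    _ ≤ (x ^ n * (t ^ 4) ^ n) / ((t ^ 4) ^ n * (1 / 4) * tail ω t ^ 2) := by gcongr
    _ = 4 / tail ω t ^ 2 * x ^ n := by field_simp
    _ ≤ (2 * C ^ 3 / tail ω x) ^ 2 * x ^ n := by
        gcongr
        rw [div_pow, div_le_div_iff₀ (by positivity) (by positivity)]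
        calc 4 * tail ω x ^ 2 ≤ 4 * (C ^ 3 * tail ω t) ^ 2 := by gcongr
          _ = _ := by ring

/-- The mean value estimate `x ^ n - y ^ n ≤ n (x - y) x ^ (n - 1)`, multiplied by `x` to avoid the
exponent `n - 1`. -/
lemma mul_pow_sub_pow_le {x y : ℝ} (hy : 0 ≤ y) (hyx : y ≤ x) (n : ℕ) :
    x * (x ^ n - y ^ n) ≤ n * ((x - y) * x ^ n) := by
  have hx := hy.trans hyx
  induction n with
  | zero => simp
  | succ n ih =>
    have h1 : y * (x * (x ^ n - y ^ n)) ≤ x * (n * ((x - y) * x ^ n)) :=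
      mul_le_mul hyx ih (mul_nonneg hx (sub_nonneg.2 (pow_le_pow_left₀ hy hyx n))) hx
    calc x * (x ^ (n + 1) - y ^ (n + 1))
        = x ^ (n + 1) * (x - y) + y * (x * (x ^ n - y ^ n)) := by ring
      _ ≤ x ^ (n + 1) * (x - y) + x * (n * ((x - y) * x ^ n)) := by gcongr
      _ = _ := by push_cast; ring

/-- Increment of the circle means between comparable radii. -/
lemma circleMean_le_add (hω : IsRadialWeight ω)
    (hpos : ∀ r ∈ Ico (0 : ℝ) 1, 0 < tail ω r) {C : ℝ}
    (hC : ∀ r ∈ Ico (0 : ℝ) 1, tail ω r ≤ C * tail ω ((1 + r) / 2)) (hC0 : 0 < C)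
    {K x y : ℝ} (hy : 0 ≤ y) (hyx : y ≤ x) (hx : x < 1) (hK : 0 < K)
    (hxy : 1 - y ≤ K * (1 - x)) :
    circleMean ω x ≤ circleMean ω y +
      2 * Real.pi * ((8 * C ^ 2 + 1) * K * (2 * C ^ 3)) / tail ω x := by
  have hx0 := hy.trans hyx
  have hxI : x ∈ Ico (0 : ℝ) 1 := ⟨hx0, hx⟩
  have hyI : y ∈ Ico (0 : ℝ) 1 := ⟨hy, hyx.trans_lt hx⟩
  have hTx := hpos x hxI
  have hpi := Real.pi_pos
  set Q : ℝ := (8 * C ^ 2 + 1) * K * (2 * C ^ 3) / tail ω x with hQ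
  have hsx := summable_norm_pow_div hω hpos hxI
  have hsy := summable_norm_pow_div hω hpos hyI
  set c : ℕ → ℂ := fun n =>
    ((x ^ n / monomialNormSq ω n : ℝ) : ℂ) - ((y ^ n / monomialNormSq ω n : ℝ) : ℂ) with hc
  have hcs : Summable fun n => ‖c n‖ :=
    Summable.of_nonneg_of_le (fun n => norm_nonneg _) (fun n => norm_sub_le _ _) (hsx.add hsy)
  have hcoef : ∀ n, ‖c (n + 1) - x * c n‖ ^ 2 ≤ (Q * (1 - x)) ^ 2 * x ^ n := by
    intro n
    set m := monomialNormSq ω n with hm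
    set m' := monomialNormSq ω (n + 1) with hm'
    have hm0 : 0 < m := monomialNormSq_pos hω hpos n
    have hm0' : 0 < m' := monomialNormSq_pos hω hpos (n + 1)
    have hmm : m' ≤ m := monomialNormSq_anti hω n.le_succ
    have hreg := mul_monomialNormSq_sub_le hω hC hC0.le n
    rw [← hm, ← hm'] at hreg
    have hpw : y ^ n ≤ x ^ n := pow_le_pow_left₀ hy hyx n
    -- Discrete product rule. In the first term the `O(1 / n)` relative decrement of the moments
    -- cancels the factor `n` from `x ^ n - y ^ n`; the second carries `x - y` directly. Both thus
    -- gain a factor `1 - x`.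
    have e : c (n + 1) - x * c n =
        (((m - m') * (x * (x ^ n - y ^ n)) / (m * m') + y ^ n * (x - y) / m' : ℝ) : ℂ) := by
      simp only [hc, ← hm, ← hm']
      norm_cast
      field_simp
      ring
    have hnn : 0 ≤ (m - m') * (x * (x ^ n - y ^ n)) / (m * m') + y ^ n * (x - y) / m' :=
      add_nonneg (div_nonneg (mul_nonneg (sub_nonneg.2 hmm)
        (mul_nonneg hx0 (sub_nonneg.2 hpw))) (by positivity))
        (div_nonneg (mul_nonneg (pow_nonneg hy n) (sub_nonneg.2 hyx)) hm0'.le)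
    have hxy0 : 0 ≤ x - y := sub_nonneg.2 hyx
    have hle : (m - m') * (x * (x ^ n - y ^ n)) / (m * m') + y ^ n * (x - y) / m' ≤
        ((8 * C ^ 2 + 1) * K * (1 - x)) * (x ^ n / m') := by
      have h1 : (m - m') * (x * (x ^ n - y ^ n)) ≤ 8 * C ^ 2 * m * ((x - y) * x ^ n) := by
        calc _ ≤ (m - m') * (n * ((x - y) * x ^ n)) :=
              mul_le_mul_of_nonneg_left (mul_pow_sub_pow_le hy hyx n) (sub_nonneg.2 hmm)
          _ = n * (m - m') * ((x - y) * x ^ n) := by ring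
          _ ≤ 8 * C ^ 2 * m * ((x - y) * x ^ n) := by
              refine mul_le_mul_of_nonneg_right ?_ (by positivity)
              calc _ ≤ _ := hreg
                _ = 8 * C ^ 2 * m' := by ring
                _ ≤ _ := by gcongr
      calc _ ≤ 8 * C ^ 2 * m * ((x - y) * x ^ n) / (m * m') + x ^ n * (x - y) / m' := by gcongr
        _ = ((8 * C ^ 2 + 1) * (x - y)) * (x ^ n / m') := by field_simp
        _ ≤ ((8 * C ^ 2 + 1) * (K * (1 - x))) * (x ^ n / m') := by
            gcongr
            linarith
        _ = _ := by ring
    rw [e, Complex.norm_real, Real.norm_eq_abs, sq_abs]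
    calc _ ≤ (((8 * C ^ 2 + 1) * K * (1 - x)) * (x ^ n / m')) ^ 2 := by gcongr
      _ = ((8 * C ^ 2 + 1) * K * (1 - x)) ^ 2 * (x ^ n / m') ^ 2 := by ring
      _ ≤ ((8 * C ^ 2 + 1) * K * (1 - x)) ^ 2 * ((2 * C ^ 3 / tail ω x) ^ 2 * x ^ n) := by
          gcongr ?_ * ?_
          exact sq_pow_div_monomialNormSq_le hω hpos hC hC0.le hxI n
      _ = _ := by rw [hQ]; ring
  have hmain := integral_norm_tsum_exp_le hcs (by simp [hc]) hx0 hx (by positivity) hcoef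
  have hcx := continuous_kernelPowerSeries_mul_exp hω hpos hxI
  have hcy := continuous_kernelPowerSeries_mul_exp hω hpos hyI
  have hcc := continuous_tsum_mul_exp hcs
  calc circleMean ω x ≤ ∫ θ in (0)..(2 * Real.pi),
        (‖kernelPowerSeries ω (y * Complex.exp (θ * Complex.I))‖ +
          ‖∑' n, c n * Complex.exp ((θ : ℝ) * Complex.I) ^ n‖) := by
        refine intervalIntegral.integral_mono_on (by positivity)
          (hcx.norm.intervalIntegrable _ _)
          ((hcy.norm.add hcc.norm).intervalIntegrable _ _) fun θ _ => ?_
        have : ∑' n, c n * Complex.exp ((θ : ℝ) * Complex.I) ^ n =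
            kernelPowerSeries ω (x * Complex.exp (θ * Complex.I)) -
              kernelPowerSeries ω (y * Complex.exp (θ * Complex.I)) := by
          rw [kernelPowerSeries_mul_exp, kernelPowerSeries_mul_exp,
            ← (summable_mul_exp hsx θ).tsum_sub (summable_mul_exp hsy θ)]
          congr 1 with n
          simp only [hc]; ring
        rw [this]
        exact norm_le_norm_add_norm_sub' _ _
    _ = circleMean ω y + ∫ θ in (0)..(2 * Real.pi),
          ‖∑' n, c n * Complex.exp ((θ : ℝ) * Complex.I) ^ n‖ :=
        intervalIntegral.integral_add (hcy.norm.intervalIntegrable _ _)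
          (hcc.norm.intervalIntegrable _ _)
    _ ≤ circleMean ω y + 2 * Real.pi * Q := by gcongr
    _ = _ := by rw [hQ]; ring

/-- For two-sided doubling weights the circle means of the kernel are `O(1 / tail)`. -/
theorem exists_circleMean_le (hω : IsRadialWeight ω)
    (hpos : ∀ r ∈ Ico (0 : ℝ) 1, 0 < tail ω r) (hD : UpperDoubling ω) (hL : LowerDoubling ω) :
    ∃ L : ℝ, 0 ≤ L ∧ ∀ x ∈ Ico (0 : ℝ) 1, circleMean ω x ≤ L / tail ω x := by
  obtain ⟨C, hC1, hC⟩ := hD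
  obtain ⟨K, c, hK, hc, hKc⟩ := hL
  have hC0 : 0 < C := by linarith
  have hpi := Real.pi_pos
  set Q : ℝ := 2 * Real.pi * ((8 * C ^ 2 + 1) * K * (2 * C ^ 3)) with hQ
  have hQ0 : 0 < Q := by positivity
  have hm := monomialNormSq_pos hω hpos 0
  have hT0 := hpos 0 (by simp)
  set A : ℝ := 2 * Real.pi / monomialNormSq ω 0 * tail ω 0 with hA
  have hA0 : 0 < A := by positivity
  have hc0 : 0 < c - 1 := by linarith
  -- The fixed point of `L = L / c + Q + A`, so that the bound reproduces itself in the induction.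
  set L : ℝ := (Q + A) * (c / (c - 1)) with hL
  have hcc : 1 ≤ c / (c - 1) := by rw [le_div_iff₀ hc0]; linarith
  have hL0 : 0 ≤ L := by positivity
  have hLQA : Q + A ≤ L := le_mul_of_one_le_right (by positivity) hcc
  have hLc : L / c + Q ≤ L := by
    have : L / c = L - (Q + A) := by
      rw [hL]; field_simp; ring
    linarith
  have hbase : ∀ x ∈ Ico (0 : ℝ) 1, circleMean ω 0 ≤ A / tail ω x := by
    intro x hx
    rw [circleMean_zero hω hpos, le_div_iff₀ (hpos x hx), hA]
    gcongr
    exact tail_anti hω (by simp) ⟨hx.1, hx.2.le⟩ hx.1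
  refine ⟨L, hL0, ?_⟩
  -- Here `n` bounds the number of steps `x ↦ 1 - K (1 - x)` needed to reach the centre. Lower
  -- doubling at the new point `y` says `c * tail ω x ≤ tail ω y`, so the inherited bound shrinks by
  -- the factor `c`.
  have key : ∀ n : ℕ, ∀ x ∈ Ico (0 : ℝ) 1, 1 ≤ K ^ n * (1 - x) →
      circleMean ω x ≤ L / tail ω x := by
    intro n
    induction n with
    | zero =>
      intro x hx h
      have hx0 : x = 0 := by simp at h; exact le_antisymm h hx.1
      have hTx := hpos x hx
      have hb := hbase x hx
      nth_rw 1 [← hx0] at hb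
      refine hb.trans ?_
      gcongr
      linarith
    | succ n ih =>
      intro x hx h
      have hTx := hpos x hx
      have hx1 : 0 < 1 - x := sub_pos.2 hx.2
      -- If the next step would leave `(0, 1)`, the comparison is made with the centre itself.
      rcases le_or_gt (1 - K * (1 - x)) 0 with hy | hy
      · have h1 := circleMean_le_add hω hpos hC hC0 le_rfl hx.1 hx.2 (K := K) (by linarith)
          (by linarith)
        calc _ ≤ _ := h1
          _ ≤ A / tail ω x + Q / tail ω x := by gcongr; exact hbase x hx
          _ = (Q + A) / tail ω x := by ring
          _ ≤ _ := by gcongr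
      · set y := 1 - K * (1 - x) with hyd
        have hyx : y ≤ x := by nlinarith
        have hyI : y ∈ Ico (0 : ℝ) 1 := ⟨hy.le, hyx.trans_lt hx.2⟩
        have h1 := circleMean_le_add hω hpos hC hC0 hy.le hyx hx.2 (K := K) (by linarith)
          (by linarith)
        have h2 := ih y hyI (by
          rw [hyd, sub_sub_cancel, ← mul_assoc, ← pow_succ]; exact h)
        have h3 := hKc y hyI
        have e : 1 - (1 - y) / K = x := by
          rw [hyd]; field_simp; ring
        rw [e] at h3
        calc _ ≤ _ := h1
          _ ≤ L / tail ω y + Q / tail ω x := by gcongr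
          _ ≤ L / (c * tail ω x) + Q / tail ω x := by gcongr
          _ = (L / c + Q) / tail ω x := by field_simp
          _ ≤ _ := by gcongr
  intro x hx
  have hx1 : 0 < 1 - x := sub_pos.2 hx.2
  obtain ⟨n, hn⟩ := pow_unbounded_of_one_lt (1 - x)⁻¹ hK
  refine key n x hx ?_
  rw [inv_lt_iff_one_lt_mul₀ hx1] at hn
  linarith

/-! ### The modulus of the kernel and averaging over rotations -/

lemma continuousOn_kernelPowerSeries (hω : IsRadialWeight ω)
    (hpos : ∀ r ∈ Ico (0 : ℝ) 1, 0 < tail ω r) :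
    ContinuousOn (kernelPowerSeries ω) (Metric.ball 0 1) := by
  intro w hw
  have hw1 : ‖w‖ < 1 := by simpa using hw
  obtain ⟨s, hs, hs1⟩ := exists_between hw1
  have hs0 : 0 ≤ s := (norm_nonneg w).trans hs.le
  have hc : ContinuousOn (kernelPowerSeries ω) (Metric.ball 0 s) := by
    refine continuousOn_tsum (fun n => by fun_prop) (summable_pow_div hω hpos ⟨hs0, hs1⟩)
      fun n v hv => ?_
    have hv' : ‖v‖ < s := by simpa using hv
    have hm := monomialNormSq_pos hω hpos n
    rw [norm_div, norm_pow, Complex.norm_real, Real.norm_eq_abs, abs_of_pos hm]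
    gcongr
  exact (hc.continuousAt (Metric.isOpen_ball.mem_nhds (by simpa using hs))).continuousWithinAt

/-- The modulus of the kernel power series, cut off to the unit disc. -/
def absKernel (ω : ℝ → ℝ) (w : ℂ) : ℝ :=
  (Metric.ball (0 : ℂ) 1).indicator (fun w => ‖kernelPowerSeries ω w‖) w

lemma absKernel_nonneg (w : ℂ) : 0 ≤ absKernel ω w := indicator_nonneg (fun _ _ => norm_nonneg _) w

lemma measurable_absKernel (hω : IsRadialWeight ω)
    (hpos : ∀ r ∈ Ico (0 : ℝ) 1, 0 < tail ω r) : Measurable (absKernel ω) := by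
  classical
  have h := (continuousOn_kernelPowerSeries hω hpos).norm.measurable_piecewise
    (continuousOn_const (c := (0 : ℝ))) Metric.isOpen_ball.measurableSet
  have e : absKernel ω = (Metric.ball (0 : ℂ) 1).piecewise
      (fun w => ‖kernelPowerSeries ω w‖) fun _ => 0 := by
    ext w
    by_cases hw : w ∈ Metric.ball (0 : ℂ) 1 <;> simp only [absKernel, indicator, piecewise, hw]
  rwa [e]

lemma norm_conj_mul_lt_one {z ζ : ℂ} (hz : z ∈ Metric.ball (0 : ℂ) 1)
    (hζ : ζ ∈ Metric.ball (0 : ℂ) 1) : ‖conj z * ζ‖ < 1 := by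
  have hz1 : ‖z‖ < 1 := by simpa using hz
  have hζ1 : ‖ζ‖ < 1 := by simpa using hζ
  rw [norm_mul, RCLike.norm_conj]
  exact mul_lt_one_of_nonneg_of_lt_one_left (norm_nonneg _) hz1 hζ1.le

/-- `bergmanKernel` is only a chosen function; its uniqueness on the disc identifies it with the
power series there, which also supplies joint measurability. -/
lemma norm_bergmanKernel_eq (hω : IsRadialWeight ω)
    (hpos : ∀ r ∈ Ico (0 : ℝ) 1, 0 < tail ω r) {z ζ : ℂ} (hz : z ∈ Metric.ball (0 : ℂ) 1)
    (hζ : ζ ∈ Metric.ball (0 : ℂ) 1) :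
    ‖bergmanKernel ω z ζ‖ = absKernel ω (conj z * ζ) := by
  rw [(isReproducingKernelAt_bergmanKernel hω hpos hz).eqOn hω hpos
    (isReproducingKernelAt_kernelSeries hω hpos hz) hζ, absKernel, indicator_of_mem
    (by simpa using norm_conj_mul_lt_one hz hζ)]
  rfl

/-- The measure `ω dA` is invariant under rotations. -/
lemma measurePreserving_mul_circle (u : Circle) :
    MeasurePreserving (fun z : ℂ => (u : ℂ) * z) (weightedArea ω) (weightedArea ω) := by
  have hemb : MeasurableEmbedding (rotation u) := (rotation u).toHomeomorph.measurableEmbedding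
  have hn : ∀ z : ℂ, ‖(u : ℂ) * z‖ = ‖z‖ := fun z => by rw [norm_mul, Circle.norm_coe, one_mul]
  have hvol : MeasurePreserving (rotation u) (volume : Measure ℂ) volume :=
    (rotation u).measurePreserving
  have hball : rotation u ⁻¹' (Metric.ball (0 : ℂ) 1) = Metric.ball 0 1 := by
    ext z
    rw [mem_preimage, mem_ball_zero_iff, mem_ball_zero_iff, rotation_apply, hn]
  have hnorm : MeasurePreserving (rotation u) normalizedArea normalizedArea := by
    have := (hvol.restrict_preimage
      (Metric.isOpen_ball (x := (0 : ℂ)) (ε := 1)).measurableSet).smul_measure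
        (ENNReal.ofReal Real.pi⁻¹)
    rwa [hball] at this
  refine ⟨by fun_prop, ?_⟩
  ext S hS
  rw [Measure.map_apply (by fun_prop) hS, weightedArea, withDensity_apply _ hS,
    withDensity_apply _ ((by fun_prop : Measurable fun z : ℂ => (u : ℂ) * z) hS)]
  refine Eq.trans ?_ (hnorm.setLIntegral_comp_preimage_emb hemb _ S)
  change ∫⁻ z in rotation u ⁻¹' S, _ ∂normalizedArea = _
  refine lintegral_congr fun z => ?_
  rw [rotation_apply, hn]

/-- The argument of `w` only shifts `θ`, which does not affect an integral over a full period. -/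
lemma lintegral_absKernel_mul_exp (hω : IsRadialWeight ω)
    (hpos : ∀ r ∈ Ico (0 : ℝ) 1, 0 < tail ω r) {w : ℂ} (hw : ‖w‖ < 1) :
    ∫⁻ θ in Ioc 0 (2 * Real.pi), ENNReal.ofReal (absKernel ω (w * Complex.exp (θ * Complex.I))) =
      ENNReal.ofReal (circleMean ω ‖w‖) := by
  have hpi := Real.pi_pos
  have hx : ‖w‖ ∈ Ico (0 : ℝ) 1 := ⟨norm_nonneg w, hw⟩
  set h : ℝ → ℝ := fun θ => ‖kernelPowerSeries ω (‖w‖ * Complex.exp (θ * Complex.I))‖ with hh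
  have hc : Continuous h := (continuous_kernelPowerSeries_mul_exp hω hpos hx).norm
  have hp : Function.Periodic h (2 * Real.pi) := by
    intro θ
    simp only [hh]
    rw [show ((θ + 2 * Real.pi : ℝ) : ℂ) * Complex.I = θ * Complex.I + 2 * Real.pi * Complex.I by
      push_cast; ring, Complex.exp_periodic]
  have h1 : ∀ θ : ℝ, absKernel ω (w * Complex.exp (θ * Complex.I)) = h (θ + Complex.arg w) := by
    intro θ
    have e : w * Complex.exp (θ * Complex.I) =
        ‖w‖ * Complex.exp ((θ + Complex.arg w : ℝ) * Complex.I) := by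
      conv_lhs => rw [← Complex.norm_mul_exp_arg_mul_I w]
      rw [mul_assoc, ← Complex.exp_add]
      congr 2
      push_cast; ring
    rw [absKernel, indicator_of_mem, e]
    simpa [Complex.norm_exp_ofReal_mul_I] using hw
  simp only [h1]
  rw [← ofReal_integral_eq_lintegral_ofReal
    ((by fun_prop : Continuous fun θ => h (θ + Complex.arg w)).intervalIntegrable 0
      (2 * Real.pi)).1 (Eventually.of_forall fun θ => norm_nonneg _),
    ← intervalIntegral.integral_of_le (by positivity), intervalIntegral.integral_comp_add_right]
  congr 1
  have := hp.intervalIntegral_add_eq (Complex.arg w) 0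
  rw [zero_add, add_comm (Complex.arg w)] at this
  rw [zero_add, this]
  rfl

/-- Averaging over rotations replaces the kernel by its circle means. -/
lemma lintegral_absKernel_mul_radial (hω : IsRadialWeight ω)
    (hpos : ∀ r ∈ Ico (0 : ℝ) 1, 0 < tail ω r) {g : ℝ → ℝ≥0∞} (hg : Measurable g)
    {z : ℂ} (hz : z ∈ Metric.ball (0 : ℂ) 1) :
    ∫⁻ ζ, ENNReal.ofReal (absKernel ω (conj z * ζ)) * g ‖ζ‖ ∂(weightedArea ω) =
      (ENNReal.ofReal (2 * Real.pi))⁻¹ *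
        ∫⁻ ζ, ENNReal.ofReal (circleMean ω (‖z‖ * ‖ζ‖)) * g ‖ζ‖ ∂(weightedArea ω) := by
  have := isFiniteMeasure_weightedArea hω
  have hpi := Real.pi_pos
  have hk := measurable_absKernel hω hpos
  set I := ∫⁻ ζ, ENNReal.ofReal (absKernel ω (conj z * ζ)) * g ‖ζ‖ ∂(weightedArea ω) with hI
  -- The rotated integral does not depend on `θ`, so it equals its average; Tonelli then moves the
  -- average onto the kernel.
  have hrot : ∀ θ : ℝ, ∫⁻ ζ, ENNReal.ofReal (absKernel ω (conj z * ζ *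
      Complex.exp (θ * Complex.I))) * g ‖ζ‖ ∂(weightedArea ω) = I := by
    intro θ
    have h := (measurePreserving_mul_circle (ω := ω) (Circle.exp θ)).lintegral_comp
      (f := fun ζ => ENNReal.ofReal (absKernel ω (conj z * ζ)) * g ‖ζ‖) (by fun_prop)
    refine Eq.trans (lintegral_congr fun ζ => ?_) h
    rw [norm_mul, Circle.norm_coe, one_mul, Circle.coe_exp]
    congr 3
    ring
  have hconst : ∫⁻ θ in Ioc 0 (2 * Real.pi), ∫⁻ ζ, ENNReal.ofReal (absKernel ω (conj z * ζ *
      Complex.exp ((θ : ℝ) * Complex.I))) * g ‖ζ‖ ∂(weightedArea ω) =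
      ENNReal.ofReal (2 * Real.pi) * I := by
    simp only [hrot]
    rw [setLIntegral_const, Real.volume_Ioc, sub_zero, mul_comm]
  rw [lintegral_lintegral_swap (by fun_prop)] at hconst
  have hin : ∫⁻ ζ, ∫⁻ θ in Ioc 0 (2 * Real.pi), ENNReal.ofReal (absKernel ω (conj z * ζ *
      Complex.exp ((θ : ℝ) * Complex.I))) * g ‖ζ‖ ∂volume ∂(weightedArea ω) =
      ∫⁻ ζ, ENNReal.ofReal (circleMean ω (‖z‖ * ‖ζ‖)) * g ‖ζ‖ ∂(weightedArea ω) := by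
    refine lintegral_congr_ae ?_
    filter_upwards [ae_mem_ball] with ζ hζ
    rw [lintegral_mul_const _ (by fun_prop),
      lintegral_absKernel_mul_exp hω hpos (norm_conj_mul_lt_one hz hζ), norm_mul,
      RCLike.norm_conj]
  rw [← hin, hconst, ← mul_assoc, ENNReal.inv_mul_cancel (by simpa using hpi)
    ENNReal.ofReal_ne_top, one_mul]

/-! ### Distribution of the tail and Schur test functions -/

/-- The tail, extended continuously by constants outside `[0, 1]`. -/
def extendedTail (ω : ℝ → ℝ) : ℝ → ℝ := IccExtend zero_le_one ((Icc (0 : ℝ) 1).domRestrict (tail ω))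

lemma continuous_extendedTail (hω : IsRadialWeight ω) : Continuous (extendedTail ω) :=
  (continuousOn_iff_continuous_domRestrict.1 (continuousOn_tail hω)).Icc_extend'

lemma extendedTail_eq {r : ℝ} (hr : r ∈ Icc (0 : ℝ) 1) : extendedTail ω r = tail ω r := by
  rw [extendedTail, IccExtend_of_mem _ _ hr]; rfl

lemma extendedTail_nonneg (hω : IsRadialWeight ω) (r : ℝ) : 0 ≤ extendedTail ω r :=
  tail_nonneg hω (projIcc (0 : ℝ) 1 zero_le_one r).2

/-- The tail, as a random variable, dominates a uniform one up to a constant. -/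
lemma measure_extendedTail_le (hω : IsRadialWeight ω) {u : ℝ} (hu : 0 ≤ u) :
    weightedArea ω {z | extendedTail ω ‖z‖ ≤ u} ≤ 2 * ENNReal.ofReal u := by
  have := isFiniteMeasure_weightedArea hω
  have hcl : IsCompact {r | r ∈ Icc (0 : ℝ) 1 ∧ tail ω r ≤ u} :=
    isCompact_Icc.of_isClosed_subset
      ((continuousOn_tail hω).preimage_isClosed_of_isClosed isClosed_Icc isClosed_Iic)
      fun _ h => h.1
  -- The tail is continuous and vanishes at `1`, so there is a smallest radius where it is at most
  -- `u`; the event lies outside that radius, up to a null set.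
  obtain ⟨r₀, hr₀, hmin⟩ := hcl.exists_isLeast ⟨1, ⟨by simp, by rwa [tail_one]⟩⟩
  have hsub : weightedArea ω {z | extendedTail ω ‖z‖ ≤ u} ≤ weightedArea ω {z | r₀ ≤ ‖z‖} := by
    refine measure_mono_ae ?_
    filter_upwards [ae_mem_ball] with z hz h
    have hzI : ‖z‖ ∈ Icc (0 : ℝ) 1 := ⟨norm_nonneg z, (by simpa using hz : ‖z‖ < 1).le⟩
    exact hmin ⟨hzI, (extendedTail_eq hzI).symm.trans_le h⟩
  refine hsub.trans ?_
  rw [← ofReal_measureReal, ← ENNReal.ofReal_ofNat 2, ← ENNReal.ofReal_mul (by norm_num)]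
  exact ENNReal.ofReal_le_ofReal ((real_le_norm_le hω hr₀.1).trans (by gcongr; exact hr₀.2))

/-- A superlevel set of a decreasing function on `(0, ∞)` is an interval starting at `0`, or the
whole half-line. By `measure_extendedTail_le` the tail falls in such an interval with mass at most
twice its length, and the layer-cake formula integrates this. Monotonicity at `0` is not needed, as
the tail is positive on the disc. -/
lemma lintegral_extendedTail_le (hω : IsRadialWeight ω)
    (hpos : ∀ r ∈ Ico (0 : ℝ) 1, 0 < tail ω r) {φ : ℝ → ℝ} (hφ : Measurable φ)
    (hφ0 : ∀ u, 0 ≤ u → 0 ≤ φ u) (hanti : AntitoneOn φ (Ioi 0)) :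
    ∫⁻ z, ENNReal.ofReal (φ (extendedTail ω ‖z‖)) ∂(weightedArea ω) ≤
      2 * ∫⁻ u in Ioi 0, ENNReal.ofReal (φ u) := by
  have hc := continuous_extendedTail hω
  rw [lintegral_eq_lintegral_meas_lt _
      (Eventually.of_forall fun z => hφ0 _ (extendedTail_nonneg hω _)) (by fun_prop),
    lintegral_eq_lintegral_meas_lt _ ?_ hφ.aemeasurable,
    ← lintegral_const_mul' _ _ (by norm_num)]
  swap
  · filter_upwards [ae_restrict_mem measurableSet_Ioi] with u hu using hφ0 u (le_of_lt hu)
  refine setLIntegral_mono' measurableSet_Ioi fun t _ => ?_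
  rw [Measure.restrict_apply (measurableSet_lt measurable_const hφ)]
  set S : Set ℝ := {u | t < φ u} ∩ Ioi 0 with hS
  have hT : ∀ᵐ z ∂(weightedArea ω), t < φ (extendedTail ω ‖z‖) → extendedTail ω ‖z‖ ∈ S := by
    filter_upwards [ae_mem_ball] with z hz h
    have hz1 : ‖z‖ < 1 := by simpa using hz
    refine ⟨h, ?_⟩
    rw [mem_Ioi, extendedTail_eq ⟨norm_nonneg z, hz1.le⟩]
    exact hpos _ ⟨norm_nonneg z, hz1⟩
  rcases S.eq_empty_or_nonempty with h0 | hne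
  · rw [h0] at hT
    have : weightedArea ω {z | t < φ (extendedTail ω ‖z‖)} = 0 := by
      rw [measure_eq_zero_iff_ae_notMem]
      filter_upwards [hT] with z hz h using hz h
    exact this.trans_le zero_le
  by_cases hbd : BddAbove S
  · set b := sSup S with hb
    have hb0 : 0 ≤ b := by
      obtain ⟨u, hu⟩ := hne
      exact (le_of_lt hu.2).trans (le_csSup hbd hu)
    have hIoo : Ioo 0 b ⊆ S := by
      intro u hu
      obtain ⟨v, hv, huv⟩ := exists_lt_of_lt_csSup hne hu.2
      exact ⟨lt_of_lt_of_le hv.1 (hanti hu.1 hv.2 huv.le), hu.1⟩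
    calc weightedArea ω {z | t < φ (extendedTail ω ‖z‖)}
        ≤ weightedArea ω {z | extendedTail ω ‖z‖ ≤ b} := by
          refine measure_mono_ae ?_
          filter_upwards [hT] with z hz h using le_csSup hbd (hz h)
      _ ≤ 2 * ENNReal.ofReal b := measure_extendedTail_le hω hb0
      _ = 2 * volume (Ioo 0 b) := by rw [Real.volume_Ioo, sub_zero]
      _ ≤ 2 * volume S := by gcongr
  · have hall : Ioi 0 ⊆ S := by
      intro u hu
      obtain ⟨v, hv, huv⟩ := not_bddAbove_iff.1 hbd u
      exact ⟨lt_of_lt_of_le hv.1 (hanti hu hv.2 huv.le), hu⟩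
    have : volume S = ⊤ := top_unique (Real.volume_Ioi.symm.trans_le (measure_mono hall))
    rw [this]
    simp

/-- The integral splits at `u = l`: integrability near `0` uses `a < 1`, integrability at infinity
uses `0 < a`. -/
lemma lintegral_rpow_div_max {a l : ℝ} (ha0 : 0 < a) (ha1 : a < 1) (hl : 0 < l) :
    ∫⁻ u in Ioi 0, ENNReal.ofReal (u ^ (-a) / max l u) =
      ENNReal.ofReal ((1 / (1 - a) + 1 / a) * l ^ (-a)) := by
  have hdis : Disjoint (Ioc 0 l) (Ioi l) := by
    rw [Set.disjoint_left]; exact fun u h1 h2 => absurd h1.2 (not_le.2 h2)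
  rw [← Ioc_union_Ioi_eq_Ioi hl.le, lintegral_union measurableSet_Ioi hdis]
  have h1 : ∫⁻ u in Ioc 0 l, ENNReal.ofReal (u ^ (-a) / max l u) =
      ENNReal.ofReal (1 / (1 - a) * l ^ (-a)) := by
    have hint := (intervalIntegral.intervalIntegrable_rpow' (a := 0) (b := l)
      (r := -a) (by linarith)).1
    calc _ = ∫⁻ u in Ioc 0 l, ENNReal.ofReal (u ^ (-a) / l) :=
          setLIntegral_congr_fun measurableSet_Ioc fun u hu => by
            simp only [max_eq_left hu.2]
      _ = ENNReal.ofReal (∫ u in Ioc 0 l, u ^ (-a) / l) := by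
          rw [ofReal_integral_eq_lintegral_ofReal (hint.div_const l)]
          filter_upwards [ae_restrict_mem measurableSet_Ioc] with u hu
          exact div_nonneg (Real.rpow_nonneg hu.1.le _) hl.le
      _ = _ := by
          rw [integral_div, ← intervalIntegral.integral_of_le hl.le,
            integral_rpow (Or.inl (by linarith)), Real.zero_rpow (by linarith),
            Real.rpow_add_one hl.ne']
          congr 1
          have : 1 - a ≠ 0 := by linarith
          rw [show -a + 1 = 1 - a by ring]
          field_simp
          ring
  have h2 : ∫⁻ u in Ioi l, ENNReal.ofReal (u ^ (-a) / max l u) =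
      ENNReal.ofReal (1 / a * l ^ (-a)) := by
    have hint := integrableOn_Ioi_rpow_of_lt (a := -a - 1) (by linarith) hl
    calc _ = ∫⁻ u in Ioi l, ENNReal.ofReal (u ^ (-a - 1)) :=
          setLIntegral_congr_fun measurableSet_Ioi fun u hu => by
            have hu0 : 0 < u := hl.trans hu
            simp only [max_eq_right (mem_Ioi.1 hu).le, Real.rpow_sub_one hu0.ne']
      _ = ENNReal.ofReal (∫ u in Ioi l, u ^ (-a - 1)) := by
          rw [ofReal_integral_eq_lintegral_ofReal hint]
          filter_upwards [ae_restrict_mem measurableSet_Ioi] with u hu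
          exact Real.rpow_nonneg (hl.trans hu).le _
      _ = _ := by
          rw [integral_Ioi_rpow_of_lt (by linarith) hl]
          congr 1
          rw [show -a - 1 + 1 = -a by ring]
          field_simp
  rw [h1, h2, ← ENNReal.ofReal_add (by have : 0 < 1 - a := by linarith
                                       positivity) (by positivity)]
  congr 1
  ring

/-- Powers of the tail are Schur test functions for the kernel. -/
lemma lintegral_absKernel_mul_rpow_le (hω : IsRadialWeight ω)
    (hpos : ∀ r ∈ Ico (0 : ℝ) 1, 0 < tail ω r) {L : ℝ} (hL0 : 0 ≤ L)
    (hL : ∀ x ∈ Ico (0 : ℝ) 1, circleMean ω x ≤ L / tail ω x) {a : ℝ} (ha0 : 0 < a) (ha1 : a < 1)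
    {z : ℂ} (hz : z ∈ Metric.ball (0 : ℂ) 1) :
    ∫⁻ ζ, ENNReal.ofReal (absKernel ω (conj z * ζ)) * ENNReal.ofReal (extendedTail ω ‖ζ‖ ^ (-a))
        ∂(weightedArea ω) ≤
      ENNReal.ofReal (L * (1 / (1 - a) + 1 / a)) * ENNReal.ofReal (extendedTail ω ‖z‖ ^ (-a)) := by
  have hpi := Real.pi_gt_three
  have hc := continuous_extendedTail hω
  have hz1 : ‖z‖ < 1 := by simpa using hz
  set l := extendedTail ω ‖z‖ with hl
  have hlz : l = tail ω ‖z‖ := extendedTail_eq ⟨norm_nonneg z, hz1.le⟩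
  have hl0 : 0 < l := hlz ▸ hpos _ ⟨norm_nonneg z, hz1⟩
  have hφm : Measurable fun u : ℝ => u ^ (-a) / max l u :=
    (measurable_id.pow_const _).div (measurable_const.max measurable_id)
  rw [lintegral_absKernel_mul_radial hω hpos
    (g := fun r => ENNReal.ofReal (extendedTail ω r ^ (-a)))
    ((hc.measurable.pow_const _).ennreal_ofReal) hz]
  have h1 : ∫⁻ ζ, ENNReal.ofReal (circleMean ω (‖z‖ * ‖ζ‖)) *
      ENNReal.ofReal (extendedTail ω ‖ζ‖ ^ (-a)) ∂(weightedArea ω) ≤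
      ∫⁻ ζ, ENNReal.ofReal L * ENNReal.ofReal ((fun u : ℝ => u ^ (-a) / max l u)
        (extendedTail ω ‖ζ‖)) ∂(weightedArea ω) := by
    refine lintegral_mono_ae ?_
    filter_upwards [ae_mem_ball] with ζ hζ
    have hζ1 : ‖ζ‖ < 1 := by simpa using hζ
    have hT : extendedTail ω ‖ζ‖ = tail ω ‖ζ‖ := extendedTail_eq ⟨norm_nonneg ζ, hζ1.le⟩
    have hprod : ‖z‖ * ‖ζ‖ ∈ Ico (0 : ℝ) 1 := ⟨by positivity,
      mul_lt_one_of_nonneg_of_lt_one_left (norm_nonneg _) hz1 hζ1.le⟩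
    -- The radius `‖z‖ * ‖ζ‖` is at most each of the two, and the tail decreases; this produces the
    -- integrand of `lintegral_rpow_div_max`.
    have hmax : max l (extendedTail ω ‖ζ‖) ≤ tail ω (‖z‖ * ‖ζ‖) := by
      rw [hT, hlz]
      exact max_le
        (tail_anti hω ⟨hprod.1, hprod.2.le⟩ ⟨norm_nonneg z, hz1.le⟩
          (mul_le_of_le_one_right (norm_nonneg _) hζ1.le))
        (tail_anti hω ⟨hprod.1, hprod.2.le⟩ ⟨norm_nonneg ζ, hζ1.le⟩
          (mul_le_of_le_one_left (norm_nonneg _) hz1.le))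
    have hmax0 : 0 < max l (extendedTail ω ‖ζ‖) := lt_max_of_lt_left hl0
    have hr : 0 ≤ extendedTail ω ‖ζ‖ ^ (-a) := Real.rpow_nonneg (extendedTail_nonneg hω _) _
    rw [← ENNReal.ofReal_mul' hr, ← ENNReal.ofReal_mul hL0]
    refine ENNReal.ofReal_le_ofReal ?_
    calc _ ≤ L / max l (extendedTail ω ‖ζ‖) * extendedTail ω ‖ζ‖ ^ (-a) := by
          gcongr
          exact (hL _ hprod).trans (by gcongr)
      _ = _ := by ring
  have h2 := lintegral_extendedTail_le hω hpos hφm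
    (fun u hu => div_nonneg (Real.rpow_nonneg hu _) (hl0.le.trans (le_max_left _ _)))
    (fun u hu v hv huv => by
      have hu0 : 0 < u := hu
      have hv0 : 0 < v := hv
      have := Real.rpow_le_rpow_of_nonpos hu0 huv (by linarith : -a ≤ 0)
      have h3 : 0 < max l u := lt_max_of_lt_left hl0
      have h4 : 0 ≤ u ^ (-a) := Real.rpow_nonneg hu0.le _
      gcongr)
  rw [lintegral_rpow_div_max ha0 ha1 hl0] at h2
  rw [lintegral_const_mul _ (by fun_prop)] at h1
  have ha : 0 < 1 - a := by linarith
  have hla : 0 ≤ l ^ (-a) := Real.rpow_nonneg hl0.le _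
  calc _ ≤ (ENNReal.ofReal (2 * Real.pi))⁻¹ * (ENNReal.ofReal L *
        (2 * ENNReal.ofReal ((1 / (1 - a) + 1 / a) * l ^ (-a)))) := by
        gcongr
        exact h1.trans (by gcongr)
    _ = ENNReal.ofReal ((2 * Real.pi)⁻¹ * (L * (2 * ((1 / (1 - a) + 1 / a) * l ^ (-a))))) := by
        rw [← ENNReal.ofReal_ofNat 2, ← ENNReal.ofReal_inv_of_pos (by positivity),
          ← ENNReal.ofReal_mul (by norm_num), ← ENNReal.ofReal_mul hL0,
          ← ENNReal.ofReal_mul (by positivity)]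
    _ ≤ ENNReal.ofReal (L * (1 / (1 - a) + 1 / a) * l ^ (-a)) := by
        refine ENNReal.ofReal_le_ofReal ?_
        have e : (2 * Real.pi)⁻¹ * (L * (2 * ((1 / (1 - a) + 1 / a) * l ^ (-a)))) =
          Real.pi⁻¹ * (L * (1 / (1 - a) + 1 / a) * l ^ (-a)) := by field_simp
        rw [e]
        exact mul_le_of_le_one_left (by positivity) (inv_le_one_of_one_le₀ (by linarith))
    _ = _ := ENNReal.ofReal_mul (by positivity)

/-! ### Schur's test and sufficiency -/

/-- **Schur's test**. -/
theorem lintegral_rpow_lintegral_mul_le_of_schur {α : Type*} [MeasurableSpace α] {μ : Measure α}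
    [SFinite μ] {k : α → α → ℝ≥0∞} (hk : Measurable (Function.uncurry k)) {h : α → ℝ≥0∞}
    (hh : Measurable h) (h0 : ∀ᵐ x ∂μ, h x ≠ 0) (ht : ∀ᵐ x ∂μ, h x ≠ ⊤) {p q : ℝ}
    (hpq : p.HolderConjugate q) {A B : ℝ≥0∞}
    (hA : ∀ᵐ x ∂μ, ∫⁻ y, k x y * h y ^ q ∂μ ≤ A * h x ^ q)
    (hB : ∀ᵐ y ∂μ, ∫⁻ x, k x y * h x ^ p ∂μ ≤ B * h y ^ p) {f : α → ℝ≥0∞} (hf : Measurable f) :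
    ∫⁻ x, (∫⁻ y, k x y * f y ∂μ) ^ p ∂μ ≤ A ^ (p / q) * B * ∫⁻ x, f x ^ p ∂μ := by
  have hp0 := hpq.pos
  have hq0 := hpq.symm.pos
  have hkx : ∀ x, Measurable (k x) := fun x => hk.comp measurable_prodMk_left
  have hk2 : Measurable fun z : α × α => k z.1 z.2 := hk
  have hpt : ∀ᵐ x ∂μ, (∫⁻ y, k x y * f y ∂μ) ^ p ≤
      A ^ (p / q) * ∫⁻ y, h x ^ p * (k x y * (f y * (h y)⁻¹) ^ p) ∂μ := by
    filter_upwards [hA] with x hx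
    -- Hölder is applied to this splitting of `k f`, so that `hA` bounds the first factor; `hB` is
    -- used after exchanging the integrals.
    have e : ∫⁻ y, k x y * f y ∂μ =
        ∫⁻ y, ((fun y => k x y ^ (1 / q) * h y) * fun y => k x y ^ (1 / p) * (f y * (h y)⁻¹)) y
          ∂μ := by
      refine lintegral_congr_ae ?_
      filter_upwards [h0, ht] with y hy0 hyt
      simp only [Pi.mul_apply]
      have h1 : k x y ^ (1 / q) * k x y ^ (1 / p) = k x y := by
        rw [← ENNReal.rpow_add_of_nonneg _ _ (by positivity) (by positivity), one_div, one_div,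
          hpq.symm.inv_add_inv_eq_one, ENNReal.rpow_one]
      calc k x y * f y = (k x y ^ (1 / q) * k x y ^ (1 / p)) * f y * (h y * (h y)⁻¹) := by
            rw [h1, ENNReal.mul_inv_cancel hy0 hyt, mul_one]
        _ = _ := by ring
    have hH := ENNReal.lintegral_mul_le_Lp_mul_Lq μ hpq.symm
      (f := fun y => k x y ^ (1 / q) * h y) (g := fun y => k x y ^ (1 / p) * (f y * (h y)⁻¹))
      (((hkx x).pow_const _).mul hh).aemeasurable
      (((hkx x).pow_const _).mul (hf.mul hh.inv)).aemeasurable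
    have e1 : ∀ y, (k x y ^ (1 / q) * h y) ^ q = k x y * h y ^ q := fun y => by
      rw [ENNReal.mul_rpow_of_nonneg _ _ hq0.le, ← ENNReal.rpow_mul, one_div_mul_cancel hq0.ne',
        ENNReal.rpow_one]
    have e2 : ∀ y, (k x y ^ (1 / p) * (f y * (h y)⁻¹)) ^ p = k x y * (f y * (h y)⁻¹) ^ p :=
      fun y => by
        rw [ENNReal.mul_rpow_of_nonneg _ _ hp0.le, ← ENNReal.rpow_mul,
          one_div_mul_cancel hp0.ne', ENNReal.rpow_one]
    simp only [e1, e2] at hH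
    calc (∫⁻ y, k x y * f y ∂μ) ^ p
        ≤ ((A * h x ^ q) ^ (1 / q) * (∫⁻ y, k x y * (f y * (h y)⁻¹) ^ p ∂μ) ^ (1 / p)) ^ p := by
          rw [e]
          gcongr
          exact hH.trans (by gcongr)
      _ = A ^ (p / q) * (h x ^ p * ∫⁻ y, k x y * (f y * (h y)⁻¹) ^ p ∂μ) := by
          rw [ENNReal.mul_rpow_of_nonneg _ _ hp0.le, ← ENNReal.rpow_mul, ← ENNReal.rpow_mul,
            one_div_mul_cancel hp0.ne', ENNReal.rpow_one,
            ENNReal.mul_rpow_of_nonneg _ _ (by positivity), ← ENNReal.rpow_mul, mul_assoc,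
            show 1 / q * p = p / q by ring, mul_div_cancel₀ p hq0.ne']
      _ = _ := by
          rw [lintegral_const_mul]
          exact (hkx x).mul ((hf.mul hh.inv).pow_const _)
  have hg : Measurable fun y => (f y * (h y)⁻¹) ^ p := (hf.mul hh.inv).pow_const _
  calc _ ≤ ∫⁻ x, A ^ (p / q) * ∫⁻ y, h x ^ p * (k x y * (f y * (h y)⁻¹) ^ p) ∂μ ∂μ :=
        lintegral_mono_ae hpt
    _ = A ^ (p / q) * ∫⁻ x, ∫⁻ y, h x ^ p * (k x y * (f y * (h y)⁻¹) ^ p) ∂μ ∂μ := by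
        rw [lintegral_const_mul]
        exact Measurable.lintegral_prod_right' (f := fun z : α × α =>
          h z.1 ^ p * (k z.1 z.2 * (f z.2 * (h z.2)⁻¹) ^ p)) (by fun_prop)
    _ = A ^ (p / q) * ∫⁻ y, ∫⁻ x, h x ^ p * (k x y * (f y * (h y)⁻¹) ^ p) ∂μ ∂μ := by
        rw [lintegral_lintegral_swap]
        exact (by fun_prop : Measurable fun z : α × α =>
          h z.1 ^ p * (k z.1 z.2 * (f z.2 * (h z.2)⁻¹) ^ p)).aemeasurable
    _ ≤ A ^ (p / q) * ∫⁻ y, B * f y ^ p ∂μ := by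
        refine mul_le_mul_right (lintegral_mono_ae ?_) _
        filter_upwards [hB, h0, ht] with y hy hy0 hyt
        have e : ∀ x, h x ^ p * (k x y * (f y * (h y)⁻¹) ^ p) =
            (f y * (h y)⁻¹) ^ p * (k x y * h x ^ p) := fun x => by ring
        simp only [e]
        rw [lintegral_const_mul _ (by fun_prop)]
        calc _ ≤ (f y * (h y)⁻¹) ^ p * (B * h y ^ p) := by gcongr
          _ = B * (f y * ((h y)⁻¹ * h y)) ^ p := by
              rw [← mul_assoc (f y), ENNReal.mul_rpow_of_nonneg _ (h y) hp0.le]; ring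
          _ = _ := by rw [ENNReal.inv_mul_cancel hy0 hyt, mul_one]
    _ = _ := by rw [lintegral_const_mul _ (hf.pow_const _), mul_assoc]

/-- The Maclaurin coefficients are real. The modulus of the kernel is thereby symmetric in `z` and
`ζ`, and one family of estimates serves both Schur conditions. -/
lemma absKernel_conj (w : ℂ) : absKernel ω (conj w) = absKernel ω w := by
  have h : kernelPowerSeries ω (conj w) = conj (kernelPowerSeries ω w) := by
    rw [kernelPowerSeries, kernelPowerSeries, Complex.conj_tsum]
    congr 1 with n
    simp
  by_cases hw : ‖w‖ < 1 <;> simp [absKernel, indicator, h, hw]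

lemma absKernel_conj_mul_comm (z ζ : ℂ) : absKernel ω (conj z * ζ) = absKernel ω (conj ζ * z) := by
  rw [← absKernel_conj (conj z * ζ)]
  congr 1
  simp [mul_comm]

lemma maximalBergmanProjection_ae_eq (hω : IsRadialWeight ω)
    (hpos : ∀ r ∈ Ico (0 : ℝ) 1, 0 < tail ω r) {f g : ℂ → ℂ} (hfg : f =ᵐ[weightedArea ω] g) :
    ∀ᵐ z ∂(weightedArea ω), maximalBergmanProjection ω f z =
      ∫ ζ, g ζ * (absKernel ω (conj z * ζ) : ℂ) ∂(weightedArea ω) := by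
  filter_upwards [ae_mem_ball] with z hz
  refine integral_congr_ae ?_
  filter_upwards [ae_mem_ball, hfg] with ζ hζ h
  rw [norm_bergmanKernel_eq hω hpos hz hζ, h]

theorem maximalProjectionBounded_of_twoSidedDoubling (hω : IsRadialWeight ω)
    (hpos : ∀ r ∈ Ico (0 : ℝ) 1, 0 < tail ω r) (hD : TwoSidedDoubling ω) {p : ℝ} (hp : 1 < p) :
    MaximalProjectionBounded ω (ENNReal.ofReal p) := by
  have := isFiniteMeasure_weightedArea hω
  obtain ⟨L, hL0, hL⟩ := exists_circleMean_le hω hpos hD.1 hD.2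
  obtain ⟨q, hpq⟩ : ∃ q, p.HolderConjugate q := ⟨_, Real.HolderConjugate.conjExponent hp⟩
  have hp0 := hpq.pos
  have hq0 := hpq.symm.pos
  have hkm := measurable_absKernel hω hpos
  have hTc := continuous_extendedTail hω
  set k : ℂ → ℂ → ℝ≥0∞ := fun z ζ => ENNReal.ofReal (absKernel ω (conj z * ζ)) with hk
  -- With this exponent `h ^ q` and `h ^ p` are the tail to the powers `-1 / p` and `-1 / q`, both
  -- exponents lying in `(-1, 0)` as the test-function estimate requires.
  set h : ℂ → ℝ≥0∞ := fun z => ENNReal.ofReal (extendedTail ω ‖z‖ ^ (-(1 / (p * q)))) with hh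
  have hTpos : ∀ᵐ z ∂(weightedArea ω), 0 < extendedTail ω ‖z‖ := by
    filter_upwards [ae_mem_ball] with z hz
    have hz1 : ‖z‖ < 1 := by simpa using hz
    rw [extendedTail_eq ⟨norm_nonneg z, hz1.le⟩]
    exact hpos _ ⟨norm_nonneg z, hz1⟩
  have hpow : ∀ s : ℝ, 0 < s → ∀ z, h z ^ s =
      ENNReal.ofReal (extendedTail ω ‖z‖ ^ (-(1 / (p * q) * s))) := by
    intro s hs z
    have := extendedTail_nonneg hω ‖z‖
    simp only [hh]
    rw [ENNReal.ofReal_rpow_of_nonneg (Real.rpow_nonneg this _) hs.le, ← Real.rpow_mul this]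
    congr 2; ring
  have hkm2 : Measurable (Function.uncurry k) := by
    have : Measurable fun z : ℂ × ℂ => ENNReal.ofReal (absKernel ω (conj z.1 * z.2)) := by fun_prop
    exact this
  have hhm : Measurable h := by fun_prop
  have key : ∀ s s' : ℝ, s.HolderConjugate s' → p * q = s * s' → ∀ᵐ z ∂(weightedArea ω),
      ∫⁻ ζ, k z ζ * h ζ ^ s ∂(weightedArea ω) ≤
        ENNReal.ofReal (L * (1 / (1 - 1 / s') + 1 / (1 / s'))) * h z ^ s := by
    intro s s' hs hss
    have hs0 := hs.pos
    have hs0' := hs.symm.pos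
    filter_upwards [ae_mem_ball] with z hz
    have e : 1 / (p * q) * s = 1 / s' := by rw [hss]; field_simp
    simp only [hpow s hs0, e]
    exact lintegral_absKernel_mul_rpow_le hω hpos hL0 hL (by positivity)
      ((div_lt_one hs0').2 hs.symm.lt) hz
  set A : ℝ≥0∞ := ENNReal.ofReal (L * (1 / (1 - 1 / p) + 1 / (1 / p))) with hA
  set B : ℝ≥0∞ := ENNReal.ofReal (L * (1 / (1 - 1 / q) + 1 / (1 / q))) with hB
  have hAq := key q p hpq.symm (mul_comm p q)
  have hBp : ∀ᵐ ζ ∂(weightedArea ω), ∫⁻ z, k z ζ * h z ^ p ∂(weightedArea ω) ≤ B * h ζ ^ p := by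
    filter_upwards [key p q hpq rfl] with ζ hζ
    simpa only [hk, absKernel_conj_mul_comm] using hζ
  have hh0 : ∀ᵐ z ∂(weightedArea ω), h z ≠ 0 := by
    filter_upwards [hTpos] with z hz
    simpa [hh] using Real.rpow_pos_of_pos hz _
  set M : ℝ≥0∞ := (A ^ (p / q) * B) ^ (1 / p) with hM
  have hMt : M ≠ ⊤ := by
    have h1 : A ^ (p / q) ≠ ⊤ := ENNReal.rpow_ne_top_of_nonneg (by positivity) ENNReal.ofReal_ne_top
    exact ENNReal.rpow_ne_top_of_nonneg (by positivity) (ENNReal.mul_ne_top h1 ENNReal.ofReal_ne_top)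
  refine ⟨M.toNNReal, fun f hf => ?_⟩
  rw [ENNReal.coe_toNNReal hMt]
  -- A strongly measurable representative of `f`: Schur's test and the measurability of the
  -- parametric integral need genuine measurability.
  set g := hf.1.mk f with hg
  have hgm : StronglyMeasurable g := hf.1.stronglyMeasurable_mk
  have hfg : f =ᵐ[weightedArea ω] g := hf.1.ae_eq_mk
  have hae := maximalBergmanProjection_ae_eq hω hpos hfg
  have hmeas : AEStronglyMeasurable (maximalBergmanProjection ω f) (weightedArea ω) := by
    have hs : StronglyMeasurable fun z : ℂ × ℂ =>
        g z.2 * (absKernel ω (conj z.1 * z.2) : ℂ) :=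
      (hgm.comp_measurable measurable_snd).mul (by
        have : Measurable fun z : ℂ × ℂ => (absKernel ω (conj z.1 * z.2) : ℂ) := by fun_prop
        exact this.stronglyMeasurable)
    exact ⟨_, hs.integral_prod_right, hae⟩
  have hp1 : ENNReal.ofReal p ≠ 0 := by simpa using hp0
  have hnorm : eLpNorm (maximalBergmanProjection ω f) (ENNReal.ofReal p) (weightedArea ω) ≤
      M * eLpNorm f (ENNReal.ofReal p) (weightedArea ω) := by
    rw [eLpNorm_congr_ae hfg, eLpNorm_eq_lintegral_rpow_enorm_toReal hp1 ENNReal.ofReal_ne_top,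
      eLpNorm_eq_lintegral_rpow_enorm_toReal hp1 ENNReal.ofReal_ne_top,
      ENNReal.toReal_ofReal hp0.le, hM, ← ENNReal.mul_rpow_of_nonneg _ _ (by positivity)]
    gcongr ?_ ^ _
    refine le_trans (lintegral_mono_ae ?_) (lintegral_rpow_lintegral_mul_le_of_schur hkm2 hhm hh0
      (Eventually.of_forall fun z => ENNReal.ofReal_ne_top) hpq hAq hBp hgm.enorm)
    filter_upwards [hae] with z hz
    gcongr
    rw [hz]
    refine (enorm_integral_le_lintegral_enorm _).trans (lintegral_mono fun ζ => le_of_eq ?_)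
    rw [enorm_mul, mul_comm]
    congr 1
    rw [← ofReal_norm, Complex.norm_real, Real.norm_eq_abs, abs_of_nonneg (absKernel_nonneg _)]
  exact ⟨⟨hmeas, hnorm.trans_lt (ENNReal.mul_lt_top hMt.lt_top hf.2)⟩, hnorm⟩

/-! ### Necessity: annuli, Hardy's inequality and a divergent harmonic sum -/

/-- Testing the maximal projection on indicators of annuli. -/
lemma exists_mul_real_lt_norm_le (hω : IsRadialWeight ω)
    (hpos : ∀ r ∈ Ico (0 : ℝ) 1, 0 < tail ω r) {p : ℝ} (hp : 0 < p)
    (hP : MaximalProjectionBounded ω (ENNReal.ofReal p)) :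
    ∃ C : ℝ, 0 ≤ C ∧ ∀ r ∈ Ioo (0 : ℝ) 1, ∀ l : ℝ, 0 ≤ l →
      (∀ x ∈ Ico (r ^ 2) 1, l ≤ circleMean ω x) →
        l * (weightedArea ω).real {z | r < ‖z‖} ≤ C := by
  have := isFiniteMeasure_weightedArea hω
  have hpi := Real.pi_pos
  obtain ⟨C, hC⟩ := hP
  refine ⟨2 * Real.pi * C, by positivity, fun r hr l hl hlx => ?_⟩
  set A : Set ℂ := {z | r < ‖z‖} with hA
  have hAm : MeasurableSet A := measurableSet_lt measurable_const measurable_norm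
  have hA0 : 0 < (weightedArea ω).real A :=
    lt_of_lt_of_le (mul_pos (mul_pos two_pos hr.1) (hpos r ⟨hr.1.le, hr.2⟩))
      (le_real_lt_norm hω ⟨hr.1.le, hr.2.le⟩)
  have hp1 : ENNReal.ofReal p ≠ 0 := by simpa using hp
  obtain ⟨-, hbound⟩ := hC (A.indicator fun _ => 1)
    (memLp_indicator_const _ hAm _ (Or.inr (measure_ne_top _ _)))
  set c : ℝ := (2 * Real.pi)⁻¹ * (l * (weightedArea ω).real A) with hc
  have hc0 : 0 ≤ c := by positivity
  -- For `z` and `ζ` both in the annulus, `‖z‖ * ‖ζ‖` lies in `[r ^ 2, 1)`, where the circle mean is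
  -- at least `l`; the averaging identity contributes the factor `(2 π)⁻¹`.
  have hlow : ∀ᵐ z ∂(weightedArea ω), z ∈ A →
      c ≤ ‖maximalBergmanProjection ω (A.indicator fun _ => 1) z‖ := by
    filter_upwards [ae_mem_ball, maximalBergmanProjection_ae_eq hω hpos
      (ae_eq_refl (A.indicator fun _ => (1 : ℂ)))] with z hz hzeq hzA
    have hz1 : ‖z‖ < 1 := by simpa using hz
    have e1 : ∀ ζ, A.indicator (fun _ => (1 : ℂ)) ζ * (absKernel ω (conj z * ζ) : ℂ) =
        ((A.indicator (fun ζ => absKernel ω (conj z * ζ)) ζ : ℝ) : ℂ) := fun ζ => by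
      by_cases hζ : ζ ∈ A <;> simp [hζ]
    simp only [e1] at hzeq
    rw [hzeq, integral_complex_ofReal, Complex.norm_real]
    have hkm := measurable_absKernel hω hpos
    have hnn : ∀ ζ, 0 ≤ A.indicator (fun ζ => absKernel ω (conj z * ζ)) ζ :=
      fun ζ => indicator_nonneg (fun _ _ => absKernel_nonneg _) ζ
    have hint : Integrable (fun ζ => A.indicator (fun ζ => absKernel ω (conj z * ζ)) ζ)
        (weightedArea ω) := by
      obtain ⟨M, hM⟩ := norm_bergmanKernel_le hω hpos hz
      refine Integrable.indicator (integrable_of_bounded hω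
        (by fun_prop : Measurable fun ζ => absKernel ω (conj z * ζ)).aestronglyMeasurable M
          fun ζ hζ => ?_) hAm
      rw [Real.norm_eq_abs, abs_of_nonneg (absKernel_nonneg _), ← norm_bergmanKernel_eq hω hpos hz hζ]
      exact hM ζ hζ
    rw [Real.norm_eq_abs, abs_of_nonneg (integral_nonneg hnn),
      ← ENNReal.ofReal_le_ofReal_iff (integral_nonneg hnn),
      ofReal_integral_eq_lintegral_ofReal hint (Eventually.of_forall hnn)]
    have e2 : ∀ ζ, ENNReal.ofReal (A.indicator (fun ζ => absKernel ω (conj z * ζ)) ζ) =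
        ENNReal.ofReal (absKernel ω (conj z * ζ)) * (Ioi r).indicator 1 ‖ζ‖ := fun ζ => by
      by_cases hζ : r < ‖ζ‖ <;> simp [hA, indicator, hζ]
    simp only [e2]
    rw [lintegral_absKernel_mul_radial hω hpos (measurable_one.indicator measurableSet_Ioi) hz]
    calc ENNReal.ofReal c = (ENNReal.ofReal (2 * Real.pi))⁻¹ *
          (ENNReal.ofReal l * weightedArea ω A) := by
          rw [hc, ENNReal.ofReal_mul (by positivity), ENNReal.ofReal_mul hl,
            ENNReal.ofReal_inv_of_pos (by positivity), ofReal_measureReal]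
      _ = (ENNReal.ofReal (2 * Real.pi))⁻¹ * ∫⁻ ζ in A, ENNReal.ofReal l ∂(weightedArea ω) := by
          rw [setLIntegral_const]
      _ ≤ (ENNReal.ofReal (2 * Real.pi))⁻¹ *
          ∫⁻ ζ in A, ENNReal.ofReal (circleMean ω (‖z‖ * ‖ζ‖)) ∂(weightedArea ω) := by
          refine mul_le_mul_right (lintegral_mono_ae ?_) _
          filter_upwards [ae_restrict_of_ae ae_mem_ball, ae_restrict_mem hAm] with ζ hζ hζA
          have hζ1 : ‖ζ‖ < 1 := by simpa using hζ
          have h1 : r < ‖z‖ := hzA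
          have h2 : r < ‖ζ‖ := hζA
          refine ENNReal.ofReal_le_ofReal (hlx _ ⟨?_, ?_⟩)
          · rw [sq]; exact mul_le_mul h1.le h2.le hr.1.le (norm_nonneg _)
          · exact mul_lt_one_of_nonneg_of_lt_one_left (norm_nonneg _) hz1 hζ1.le
      _ = _ := by
          rw [← lintegral_indicator hAm]
          congr 1
          refine lintegral_congr fun ζ => ?_
          by_cases hζ : r < ‖ζ‖ <;> simp [hA, indicator, hζ]
  have hle : eLpNorm (A.indicator fun _ => c) (ENNReal.ofReal p) (weightedArea ω) ≤
      C * eLpNorm (A.indicator fun _ => (1 : ℂ)) (ENNReal.ofReal p) (weightedArea ω) := by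
    refine le_trans (eLpNorm_mono_ae ?_) hbound
    filter_upwards [hlow] with z hz
    by_cases hzA : z ∈ A
    · simpa [hzA, abs_of_nonneg hc0] using hz hzA
    · simp [hzA]
  -- Both norms contain the same power of the mass of `A`, positive and finite, so it cancels and
  -- leaves a bound for `c`.
  rw [eLpNorm_indicator_const hAm hp1 ENNReal.ofReal_ne_top,
    eLpNorm_indicator_const hAm hp1 ENNReal.ofReal_ne_top, enorm_one, one_mul,
    ENNReal.mul_le_mul_iff_left] at hle
  · rw [Real.enorm_eq_ofReal hc0, ← ENNReal.ofReal_coe_nnreal,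
      ENNReal.ofReal_le_ofReal_iff (by positivity), hc] at hle
    rw [inv_mul_le_iff₀ (by positivity)] at hle
    exact hle
  · refine (ENNReal.rpow_pos ?_ (measure_ne_top _ _)).ne'
    exact (ENNReal.toReal_pos_iff.1 hA0).1
  · exact ENNReal.rpow_ne_top_of_nonneg (by positivity) (measure_ne_top _ _)

/-- With `D < 2 ^ B`, the power `D ^ j` is at most a fixed power of `2 ^ j`, which loses to the
exponential `(1 / 2) ^ (2 ^ j)`. The exponent `2 ^ j - 1` costs a factor `2`, hence the target `1 /
4` in the proof. -/
lemma exists_pow_mul_half_pow_le (D : ℝ) (hD : 1 ≤ D) :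
    ∃ j : ℕ, D ^ j * (1 / 2) ^ (2 ^ j - 1) ≤ 1 / 2 := by
  obtain ⟨B, hB⟩ := pow_unbounded_of_one_lt D (one_lt_two)
  have h1 := tendsto_pow_const_mul_const_pow_of_abs_lt_one B
    (r := (1 / 2 : ℝ)) (by rw [abs_of_pos] <;> norm_num)
  have h2 := h1.comp (tendsto_pow_atTop_atTop_of_one_lt (one_lt_two (α := ℕ)))
  obtain ⟨j, hj⟩ := (h2.eventually_le_const (by norm_num : (0 : ℝ) < 1 / 4)).exists
  refine ⟨j, ?_⟩
  simp only [Function.comp] at hj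
  have h3 : D ^ j ≤ ((2 ^ j : ℕ) : ℝ) ^ B := by
    push_cast
    rw [← pow_mul, mul_comm, pow_mul]
    exact pow_le_pow_left₀ (by linarith) hB.le j
  have h4 : (1 / 2 : ℝ) ^ (2 ^ j - 1) = 2 * (1 / 2) ^ (2 ^ j) := by
    have : 2 ^ j = (2 ^ j - 1) + 1 := (Nat.sub_add_cancel Nat.one_le_two_pow).symm
    conv_rhs => rw [this, pow_succ]
    ring
  rw [h4]
  have h5 : (0 : ℝ) < (1 / 2) ^ (2 ^ j) := by positivity
  nlinarith [mul_le_mul_of_nonneg_right h3 h5.le]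

/-- Moments are controlled by the tail at the natural scale. -/
lemma exists_monomialNormSq_le (hω : IsRadialWeight ω) (hD : UpperDoubling ω) :
    ∃ C : ℝ, 0 < C ∧ ∀ r ∈ Ico (0 : ℝ) 1, ∀ N : ℕ, 1 / 2 ≤ N * (1 - r) →
      monomialNormSq ω N ≤ C * tail ω r := by
  have := isFiniteMeasure_weightedArea hω
  obtain ⟨C, hC1, hC⟩ := hD
  -- The number of moment doublings is chosen so that their cost `(2 C) ^ j`, times the decay gained
  -- inside radius `r`, is at most `1 / 2`; that part is then absorbed into the left-hand side.
  obtain ⟨j, hj⟩ := exists_pow_mul_half_pow_le (2 * C) (by linarith)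
  refine ⟨4 * (2 * C) ^ j, by positivity, fun r hr N hN => ?_⟩
  have hr1 : 0 < 1 - r := sub_pos.2 hr.2
  have hN0 : N ≠ 0 := by
    rintro rfl
    norm_num at hN
  have hrN : r ^ (2 * N) ≤ 1 / 2 := by
    have h1 : r ≤ Real.exp (-(1 - r)) := by linarith [Real.add_one_le_exp (-(1 - r))]
    calc r ^ (2 * N) ≤ Real.exp (-(1 - r)) ^ (2 * N) := pow_le_pow_left₀ hr.1 h1 _
      _ = Real.exp (-(2 * (N * (1 - r)))) := by
          rw [← Real.exp_nat_mul]; congr 1; push_cast; ring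
      _ ≤ Real.exp (-1) := Real.exp_le_exp.2 (by linarith)
      _ ≤ 1 / 2 := by
          rw [Real.exp_neg, one_div]
          gcongr
          linarith [Real.add_one_le_exp 1]
  set m := monomialNormSq ω N with hm
  have hm0 : 0 ≤ m := integral_nonneg fun z => by positivity
  have h1 : m ≤ (2 * C) ^ j * ∫ z, ‖z‖ ^ (2 ^ j * (2 * N)) ∂(weightedArea ω) :=
    integral_norm_pow_le_two_pow_mul hω hC (by linarith) (by omega) j
  have hms : MeasurableSet {z : ℂ | r ≤ ‖z‖} := measurableSet_le measurable_const measurable_norm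
  -- For `‖z‖ < r` one has `‖z‖ ^ (2 N) ≤ 1 / 2`: of the `2 ^ j` copies of this factor, all but one
  -- are replaced by `1 / 2` and the last restores the original moment.
  have h2 : ∫ z, ‖z‖ ^ (2 ^ j * (2 * N)) ∂(weightedArea ω) ≤
      2 * tail ω r + (1 / 2) ^ (2 ^ j - 1) * m := by
    calc _ ≤ ∫ z, ({z : ℂ | r ≤ ‖z‖}.indicator (fun _ => (1 : ℝ)) z +
          (1 / 2) ^ (2 ^ j - 1) * ‖z‖ ^ (2 * N)) ∂(weightedArea ω) := by
          refine integral_mono_ae (integrable_norm_pow hω _)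
            (((integrable_const _).indicator hms).add ((integrable_norm_pow hω _).const_mul _)) ?_
          filter_upwards [ae_mem_ball] with z hz
          have hz1 : ‖z‖ < 1 := by simpa using hz
          by_cases hrz : r ≤ ‖z‖
          · have e : {z : ℂ | r ≤ ‖z‖}.indicator (fun _ => (1 : ℝ)) z = 1 :=
              indicator_of_mem (s := {z : ℂ | r ≤ ‖z‖}) hrz _
            rw [e]
            have h3 := pow_le_one₀ (n := 2 ^ j * (2 * N)) (norm_nonneg z) hz1.le
            have h4 : 0 ≤ (1 / 2 : ℝ) ^ (2 ^ j - 1) * ‖z‖ ^ (2 * N) := by positivity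
            linarith
          · have e : {z : ℂ | r ≤ ‖z‖}.indicator (fun _ => (1 : ℝ)) z = 0 :=
              indicator_of_notMem (s := {z : ℂ | r ≤ ‖z‖}) hrz _
            rw [e, zero_add]
            have h3 : ‖z‖ ^ (2 * N) ≤ 1 / 2 :=
              (pow_le_pow_left₀ (norm_nonneg z) (not_le.1 hrz).le _).trans hrN
            have h4 : 2 ^ j = (2 ^ j - 1) + 1 := (Nat.sub_add_cancel Nat.one_le_two_pow).symm
            rw [mul_comm (2 ^ j), pow_mul]
            conv_lhs => rw [h4, pow_succ]
            gcongr
      _ = (weightedArea ω).real {z | r ≤ ‖z‖} + (1 / 2) ^ (2 ^ j - 1) * m := by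
          rw [integral_add ((integrable_const _).indicator hms)
            ((integrable_norm_pow hω _).const_mul _), integral_indicator_const _ hms,
            integral_const_mul, smul_eq_mul, mul_one]
          rfl
      _ ≤ _ := by gcongr; exact real_le_norm_le hω ⟨hr.1, hr.2.le⟩
  have h3 : (2 * C) ^ j * ∫ z, ‖z‖ ^ (2 ^ j * (2 * N)) ∂(weightedArea ω) ≤
      (2 * C) ^ j * (2 * tail ω r + (1 / 2) ^ (2 ^ j - 1) * m) := by gcongr
  nlinarith [mul_le_mul_of_nonneg_right hj hm0]

/-- Each dyadic block has `2 ^ J * N` terms, each at least half the reciprocal of that number, and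
so contributes at least `1 / 2`. -/
lemma half_le_sum_inv_Ico {N : ℕ} (hN : 1 ≤ N) (J : ℕ) :
    (J : ℝ) / 2 ≤ ∑ n ∈ Finset.Ico N (2 ^ J * N), (n : ℝ)⁻¹ := by
  induction J with
  | zero => simp
  | succ J ih =>
    have hle : N ≤ 2 ^ J * N := Nat.le_mul_of_pos_left N (by positivity)
    have hle' : 2 ^ J * N ≤ 2 ^ (J + 1) * N := by gcongr <;> omega
    rw [← Finset.sum_Ico_consecutive _ hle hle']
    have h2 : (1 : ℝ) / 2 ≤ ∑ n ∈ Finset.Ico (2 ^ J * N) (2 ^ (J + 1) * N), (n : ℝ)⁻¹ := by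
      have hpos : (0 : ℝ) < 2 ^ J * N := by positivity
      have h3 := Finset.card_nsmul_le_sum (Finset.Ico (2 ^ J * N) (2 ^ (J + 1) * N))
        (fun n => (n : ℝ)⁻¹) ((2 ^ (J + 1) * N : ℝ)⁻¹) fun n hn => by
          rw [Finset.mem_Ico] at hn
          have hn0 : 0 < n := lt_of_lt_of_le (by positivity) hn.1
          have : (n : ℝ) ≤ 2 ^ (J + 1) * N := by exact_mod_cast hn.2.le
          gcongr
      refine le_trans (le_of_eq ?_) h3
      rw [Nat.card_Ico, show 2 ^ (J + 1) * N - 2 ^ J * N = 2 ^ J * N by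
        rw [pow_succ, mul_assoc, mul_left_comm, two_mul, Nat.add_sub_cancel],
        nsmul_eq_mul]
      push_cast
      field_simp
      ring
    push_cast
    linarith

theorem lowerDoubling_of_maximalProjectionBounded (hω : IsRadialWeight ω)
    (hpos : ∀ r ∈ Ico (0 : ℝ) 1, 0 < tail ω r) (hD : UpperDoubling ω) {p : ℝ} (hp : 0 < p)
    (hP : MaximalProjectionBounded ω (ENNReal.ofReal p)) : LowerDoubling ω := by
  obtain ⟨C, hC0, hC⟩ := exists_mul_real_lt_norm_le hω hpos hp hP
  obtain ⟨D, hD0, hDm⟩ := exists_monomialNormSq_le hω hD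
  -- The logarithmic gain `J / 2` must exceed `2 C D`, where the `2` is the lower doubling constant
  -- to be reached.
  obtain ⟨J, hJ⟩ := exists_nat_gt (4 * (C * D))
  have hJ0 : (0 : ℝ) < J := lt_of_le_of_lt (by positivity) hJ
  have h2J : (1 : ℝ) ≤ 2 ^ J := one_le_pow₀ (by norm_num)
  set K : ℝ := 4 * 2 ^ J with hK
  have hK0 : 0 < K := by positivity
  refine ⟨K, 2, by linarith, by norm_num, fun s hs => ?_⟩
  have hs1 : 0 < 1 - s := sub_pos.2 hs.2
  -- The frequency matching `s`: `N (1 - s)` lies in `[1 / 2, 1]`, the lower end being needed for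
  -- the moment bound and the upper end for `hrpow`.
  set N : ℕ := ⌊(1 - s)⁻¹⌋₊ with hN
  have hinv : 1 ≤ (1 - s)⁻¹ := by
    rw [one_le_inv₀ hs1]; linarith [hs.1]
  have hN1 : 1 ≤ N := by rw [hN, Nat.one_le_floor_iff]; exact hinv
  have hN1' : (1 : ℝ) ≤ N := by exact_mod_cast hN1
  have hNle : N * (1 - s) ≤ 1 := by
    rw [← le_div_iff₀ hs1, one_div]; exact Nat.floor_le (by positivity)
  have hNge : 1 / 2 ≤ N * (1 - s) := by
    have h1 := Nat.lt_floor_add_one (1 - s)⁻¹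
    rw [← hN, inv_lt_iff_one_lt_mul₀ hs1] at h1
    nlinarith
  set r : ℝ := 1 - (1 - s) / K with hr
  have hsK : (1 - s) / K ≤ 1 / 4 := by
    rw [div_le_iff₀ hK0]; linarith [hs.1]
  have hsK0 : 0 < (1 - s) / K := by positivity
  have hrI : r ∈ Ioo (0 : ℝ) 1 := ⟨by linarith, by linarith⟩
  have hTr := hpos r ⟨hrI.1.le, hrI.2⟩
  have hmN := monomialNormSq_pos hω hpos N
  -- The choice `K = 4 * 2 ^ J` makes the Bernoulli loss `N (1 - s) / 2 ≤ 1 / 2`, so on `[r ^ 2, 1)`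
  -- every power below `2 ^ J * N` is still at least `1 / 2`.
  have hrpow : 1 / 2 ≤ r ^ (2 * (2 ^ J * N)) := by
    have h1 := one_add_mul_le_pow (a := -((1 - s) / K)) (by linarith) (2 * (2 ^ J * N))
    have e : 1 + -((1 - s) / K) = r := by rw [hr]; ring
    have e2 : (((2 * (2 ^ J * N) : ℕ)) : ℝ) * -((1 - s) / K) = -(N * (1 - s) / 2) := by
      rw [hK]; push_cast; field_simp; ring
    rw [e, e2] at h1
    linarith
  have hmean : ∀ x ∈ Ico (r ^ 2) 1, J / 2 / monomialNormSq ω N ≤ circleMean ω x := by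
    intro x hx
    have hx0 : 0 ≤ x := (sq_nonneg r).trans hx.1
    refine le_trans ?_ (sum_pow_div_le_circleMean hω hpos ⟨hx0, hx.2⟩
      (Finset.Ico N (2 ^ J * N)))
    calc (J : ℝ) / 2 / monomialNormSq ω N
        ≤ (∑ n ∈ Finset.Ico N (2 ^ J * N), (n : ℝ)⁻¹) / monomialNormSq ω N := by
          gcongr; exact half_le_sum_inv_Ico hN1 J
      _ = 2 * ∑ n ∈ Finset.Ico N (2 ^ J * N), 1 / 2 / monomialNormSq ω N / n := by
          rw [Finset.sum_div, Finset.mul_sum]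
          refine Finset.sum_congr rfl fun n _ => ?_
          ring
      _ ≤ _ := by
          gcongr with n hn
          · exact monomialNormSq_pos hω hpos n
          · rw [Finset.mem_Ico] at hn
            calc (1 : ℝ) / 2 ≤ r ^ (2 * (2 ^ J * N)) := hrpow
              _ = (r ^ 2) ^ (2 ^ J * N) := pow_mul _ _ _
              _ ≤ x ^ (2 ^ J * N) := pow_le_pow_left₀ (sq_nonneg r) hx.1 _
              _ ≤ x ^ n := pow_le_pow_of_le_one hx0 hx.2.le hn.2.le
          · rw [Finset.mem_Ico] at hn
            exact monomialNormSq_anti hω hn.1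
  have hmain := hC r hrI _ (by positivity) hmean
  have hmass := le_real_lt_norm hω ⟨hrI.1.le, hrI.2.le⟩
  have hmass' : tail ω r ≤ (weightedArea ω).real {z | r < ‖z‖} := by nlinarith
  have hmm := hDm s hs N hNge
  have h1 : J / 2 / monomialNormSq ω N * tail ω r ≤ C :=
    le_trans (by gcongr) hmain
  have h2 : J / 2 * tail ω r ≤ C * (D * tail ω s) := by
    rw [div_mul_eq_mul_div, div_le_iff₀ hmN] at h1
    exact h1.trans (by gcongr)
  have hTs := hpos s hs
  -- Otherwise `J / 2 * tail ω r ≤ C D tail ω s ≤ 2 C D tail ω r`, against the choice of `J`.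
  by_contra! hcon
  nlinarith [mul_lt_mul_of_pos_right hJ hTr, mul_nonneg hC0 hD0.le,
    mul_le_mul_of_nonneg_left hcon.le (mul_nonneg hC0 hD0.le)]

end RadialBergman

end

theorem theorem8 (ω : ℝ → ℝ) (hω : RadialBergman.IsRadialWeight ω)
    (hpos : ∀ r ∈ Set.Ico (0 : ℝ) 1, 0 < RadialBergman.tail ω r)
    (hD : RadialBergman.UpperDoubling ω) (p : ℝ) (hp : 1 < p) :
    RadialBergman.MaximalProjectionBounded ω (ENNReal.ofReal p) ↔
      RadialBergman.TwoSidedDoubling ω :=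
  ⟨fun h => ⟨hD, RadialBergman.lowerDoubling_of_maximalProjectionBounded hω hpos hD
      (zero_lt_one.trans hp) h⟩,
    fun h => RadialBergman.maximalProjectionBounded_of_twoSidedDoubling hω hpos h hp⟩
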